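/- Let $\mathbb D$ be the open unit disc. For $0<p<\infty$ and $f$ holomorphic on $\mathbb D$ let $$\|f\|_{H^p}=\sup_{0<r<1}\Big(\int_0^{2\pi}|f(re^{i\theta})|^p\frac{d\theta}{2\pi}\Big)^{1/p},$$ for $\alpha>1$ let $$\|f\|_{A^p_\alpha}=\Big(\int_{\mathbb D}|f(z)|^p(\alpha-1)(1-|z|^2)^{\alpha-2}\,\frac{dx\,dy}{\pi}\Big)^{1/p},$$ and put $\|f\|_{A^p_1}=\|f\|_{H^p}$. Let $H^2$ be the space of holomorphic $f$ on $\mathbb D$ with $\|f\|_{H^2}<\infty$. For $w\in\mathbb D$ and $\alpha>0$ let $K_{w,\alpha}(z)=(1-\overline w z)^{-\alpha}$ (principal branch). An inner function is a holomorphic $\eta$ on $\mathbb D$ with $|\eta|\le 1$ whose radial limits have modulus $1$ almost everywhere on the unit circle. **Theorem.** Let $f\in H^2$ with $f=\eta F$, where $\eta$ is inner and $F$ is holomorphic without zeros in $\mathbb D$. Let $\alpha>1$, and let $F^\alpha=e^{\alpha L}$, where $L$ is a holomorphic function on $\mathbb D$ with $F=e^L$. Suppose that $$F^\alpha=c_1K_{w_1,\alpha}+c_2K_{w_2,\alpha}\quad\text{on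 }\mathbb D$$ for some $c_1,c_2\in\mathbb C$ and $w_1,w_2\in\mathbb D$. Then $$\|F\|_{A^{2\alpha}_\alpha}\le\|F\|_{A^{2\beta}_\beta}\qquad\text{for every }1\le\beta\le\alpha,$$ and for every $1\le\beta<\alpha$ equality holds if and only if $F^\alpha=cK_{w,\alpha}$ for some $c\in\mathbb C$, $w\in\mathbb D$. Consequently $$\|f\|_{A^{2\alpha}_\alpha}\le\|f\|_{H^2},$$ with equality if and only if $f=cK_{w,1}$ for some $c\in\mathbb C$, $w\in\mathbb D$. -/

import Mathlib

open MeasureTheory Set Filter Topology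
open scoped ENNReal

noncomputable section

namespace DiskSpaces

/-- The open unit disc. -/
def disc : Set ℂ := Metric.ball 0 1

/-- The Möbius invariant measure `dμ(z) = (1 - |z|²)⁻² dx dy / π` on the unit disc. -/
def invariantMeasure : Measure ℂ :=
  (volume.restrict disc).withDensity
    (fun z => ENNReal.ofReal (((1 - ‖z‖ ^ 2) ^ 2)⁻¹ / Real.pi))

/-- The Hardy norm `sup_{0<r<1} (∫₀^{2π} |f(re^{iθ})|^p dθ/2π)^{1/p}`, as an extended
nonnegative number. -/
def hardyNorm (p : ℝ) (f : ℂ → ℂ) : ℝ≥0∞ :=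
  ⨆ r ∈ Ioo (0 : ℝ) 1,
    (∫⁻ θ in Ioc (0 : ℝ) (2 * Real.pi),
      ENNReal.ofReal (‖f (r * Complex.exp (θ * Complex.I))‖ ^ p / (2 * Real.pi))) ^ (1 / p)

/-- The Hardy space `H^p` on the unit disc. -/
def MemHardy (p : ℝ) (f : ℂ → ℂ) : Prop :=
  DifferentiableOn ℂ f disc ∧ hardyNorm p f < ∞

/-- The norm of the weighted Bergman space `A_α^p`, `α ≥ 1`, as an extended nonnegative number:
`(∫_𝔻 |f(z)|^p (α - 1) (1 - |z|²)^α dμ(z))^{1/p}` for `α > 1`, and the Hardy norm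
for `α = 1`. -/
def bergmanNorm (α p : ℝ) (f : ℂ → ℂ) : ℝ≥0∞ :=
  if α = 1 then hardyNorm p f
  else (∫⁻ z, ENNReal.ofReal (‖f z‖ ^ p * (α - 1) * (1 - ‖z‖ ^ 2) ^ α)
    ∂invariantMeasure) ^ (1 / p)

/-- The kernel `K_{w,α}(z) = (1 - w̄ z)^{-α}`. The principal branch is used;
`1 - w̄ z` has positive real part for `w, z` in the disc. -/
def kernel (w : ℂ) (α : ℝ) (z : ℂ) : ℂ :=
  1 / (1 - (starRingEnd ℂ) w * z) ^ (α : ℂ)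

/-- Inner functions: holomorphic on the disc, bounded by one, with radial limits of modulus one
at almost every boundary point. -/
def IsInner (η : ℂ → ℂ) : Prop :=
  DifferentiableOn ℂ η disc ∧ (∀ z ∈ disc, ‖η z‖ ≤ 1) ∧
    ∀ᵐ θ : ℝ, ∃ ζ : ℂ, ‖ζ‖ = 1 ∧
      Tendsto (fun r : ℝ => η (r * Complex.exp (θ * Complex.I))) (𝓝[<] 1) (𝓝 ζ)

/-- `G` is a holomorphic determination of the power `F ^ a` on the disc: `F = e^L` and
`G = e^{aL}` for a holomorphic logarithm `L` of `F`. -/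
def IsHolomorphicPower (F : ℂ → ℂ) (a : ℝ) (G : ℂ → ℂ) : Prop :=
  ∃ L : ℂ → ℂ, DifferentiableOn ℂ L disc ∧
    (∀ z ∈ disc, F z = Complex.exp (L z)) ∧ ∀ z ∈ disc, G z = Complex.exp (a * L z)

end DiskSpaces

end

/-!
Write `F = e^L`. For every `β ≥ 1` the norm of `F` in `A^{2β}_β` is a power of the Hilbert space norm
of `e^{βL}` in `A²_β`, the space with reproducing kernel `K_{w,β}`; in terms of Taylor coefficients
this holds for the Hardy space `β = 1` as well (`bergmanNorm_eq`). The whole family of norms can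
therefore be compared through the Gram matrices of `e^{βL}` and the two kernels at `w₁` and `w₂`:
up to normalization, their entries are the `β`-th powers of numbers that do not depend on `β`.

Normalize `F` to have norm one in `A^{2β}_β`. The Gram matrix at `β` is positive semidefinite with
unit diagonal. Its entrywise power `α / β > 1` is again positive, even strictly unless some entry
off the diagonal is unimodular (`norm_exp_sub_exp_sq_lt`). At the exponent `α` the function
`e^{αL} = F^α` lies in the span of the two kernels, so that the actual Gram matrix is singular
(`norm_sq_mul_eq_of_span`); it differs from the entrywise power only in the diagonal entry
`‖F^α‖²`, which is therefore less than one (`bergmanNorm_lt`). A unimodular entry means that two of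
the three vectors are proportional, and then `F^α` is a multiple of one kernel; in that case all
norms are equal (`bergmanNorm_of_log_eq`).

Entrywise powers with a non-integral exponent depend on the branch of the logarithm, and they can
destroy positivity for a wrong choice; a bound by `π` for the argument of the cyclic product of the
entries off the diagonal prevents this. This is where zero-freeness enters (`abs_im_lt_pi`): along the hyperbolic
geodesic from `w₁` to `w₂` the function `F^α (1 - w̄₁ z)^α` takes values on a line, and it does not
vanish.

For `f = η F`, the formula for `F^α` shows that `|F|` is continuous up to the circle, so that `f` and
`F` have the same Hardy norm (`hardyNorm_two_eq_of_inner`), while `|f| ≤ |F|` in the disc, with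
strict inequality everywhere unless `η` is a constant.
-/

namespace DiskSpaces

open scoped ComplexConjugate

/-! ### Gram matrices of three vectors and their powers -/

/-- The comparison of derivatives behind `norm_exp_sub_exp_sq_lt`: the arithmetic-geometric mean
inequality with a free weight `l`. -/
lemma rpow_mul_lt_of_sq_lt {γ l a c d e n m : ℝ} (hγ : 1 < γ) (hl : 0 < l) (ha : 0 < a)
    (hc : 0 < c) (hn : 0 < n) (hd : 0 < d) (he : 0 < e) (h1 : n ^ 2 < a * c)
    (h2 : m ^ 2 ≤ d * e) :
    n ^ (γ - 1) * m < 1 / 2 * (l * (d * a ^ (γ - 1)) + l⁻¹ * (e * c ^ (γ - 1))) := by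
  have ha' := Real.rpow_pos_of_pos ha (γ - 1)
  have hc' := Real.rpow_pos_of_pos hc (γ - 1)
  have h3 : (n ^ (γ - 1)) ^ 2 < a ^ (γ - 1) * c ^ (γ - 1) := by
    rw [← Real.mul_rpow ha.le hc.le, ← Real.rpow_natCast, ← Real.rpow_mul hn.le, mul_comm,
      Real.rpow_mul hn.le]
    exact Real.rpow_lt_rpow (by positivity) (by exact_mod_cast h1) (by linarith)
  have h4 : (n ^ (γ - 1) * m) ^ 2 < (d * a ^ (γ - 1)) * (e * c ^ (γ - 1)) := by
    rw [mul_pow]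
    calc _ ≤ (n ^ (γ - 1)) ^ 2 * (d * e) := by gcongr
      _ < (a ^ (γ - 1) * c ^ (γ - 1)) * (d * e) := mul_lt_mul_of_pos_right h3 (mul_pos hd he)
      _ = _ := by ring
  refine lt_of_pow_lt_pow_left₀ 2 (by positivity) (h4.trans_le ?_)
  have : (d * a ^ (γ - 1)) * (e * c ^ (γ - 1))
      = (l * (d * a ^ (γ - 1))) * (l⁻¹ * (e * c ^ (γ - 1))) := by field_simp
  rw [this]
  nlinarith [sq_nonneg (l * (d * a ^ (γ - 1)) - l⁻¹ * (e * c ^ (γ - 1)))]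

set_option maxHeartbeats 800000 in
open Complex in
/-- Powers of a `3 × 3` positive semidefinite correlation matrix. With `p = e^P`, `q = e^Q` and
`|q| = x z`, the hypothesis `|p - q|² ≤ (1 - x²)(1 - z²)` says that the determinant of such a matrix
is nonnegative, and the conclusion that the determinant becomes positive when all entries are
raised to a power `γ > 1`. The powers are taken along the logarithms `P` and `Q`, whence the
condition on the arguments.

As for the Hadamard powers of FitzGerald and Horn, `p^γ - q^γ` is obtained by integrating the
derivative of `(q + t (p - q))^γ`, and positivity along the segment gives
`|q + t (p - q)|² < A C` with `A = x² + t (1 - x²)` and `C = z² + t (1 - z²)`. In place of the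
Cauchy-Schwarz inequality for the integral, the derivative is compared with that of
`(l A^γ + l⁻¹ C^γ) / 2`. -/
lemma norm_exp_sub_exp_sq_lt {P Q : ℂ} {x z γ : ℝ} (hx0 : 0 < x) (hx1 : x < 1) (hz0 : 0 < z)
    (hz1 : z < 1) (hγ : 1 < γ) (hQ : ‖exp Q‖ = x * z) (hP : ‖exp P‖ < 1)
    (him : |(P - Q).im| < Real.pi)
    (h : ‖exp P - exp Q‖ ^ 2 ≤ (1 - x ^ 2) * (1 - z ^ 2)) :
    ‖exp (γ * P) - exp (γ * Q)‖ ^ 2 < (1 - (x ^ 2) ^ γ) * (1 - (z ^ 2) ^ γ) := by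
  have hγ0 : 0 < γ := by linarith
  have hxx : x ^ 2 < 1 := by nlinarith
  have hzz : z ^ 2 < 1 := by nlinarith
  have hX : 0 < 1 - (x ^ 2) ^ γ := by
    have := Real.rpow_lt_one (by positivity) hxx hγ0; linarith
  have hZ : 0 < 1 - (z ^ 2) ^ γ := by
    have := Real.rpow_lt_one (by positivity) hzz hγ0; linarith
  -- rotate so that the first number becomes positive
  set p : ℝ := Real.exp P.re with hp
  set D : ℂ := Q - P.im * I with hD
  set q : ℂ := exp D with hq
  have hDim : D.im = -(P - Q).im := by simp [hD]
  have hDl : -Real.pi < D.im := by rw [hDim]; linarith [(abs_lt.1 him).2]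
  have hDu : D.im < Real.pi := by rw [hDim]; linarith [(abs_lt.1 him).1]
  have hlogq : log q = D := log_exp hDl hDu.le
  have hp0 : 0 < p := Real.exp_pos _
  have hp1 : p < 1 := by rwa [norm_exp] at hP
  have hqn : ‖q‖ = x * z := by
    rw [← hQ, hq, norm_exp, norm_exp, hD]; simp
  have hPe : exp P = exp (P.im * I) * p := by
    rw [hp, ofReal_exp, ← exp_add]; congr 1; apply Complex.ext <;> simp
  have hQe : exp Q = exp (P.im * I) * q := by
    rw [hq, ← exp_add, hD]; congr 1; ring
  have hγPe : exp (γ * P) = exp ((γ * P.im : ℝ) * I) * (p : ℂ) ^ (γ : ℂ) := by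
    rw [cpow_def_of_ne_zero (by exact_mod_cast hp0.ne'), ← ofReal_log hp0.le, hp, Real.log_exp,
      ← exp_add]
    congr 1; apply Complex.ext <;> simp; ring
  have hγQe : exp (γ * Q) = exp ((γ * P.im : ℝ) * I) * q ^ (γ : ℂ) := by
    rw [cpow_def_of_ne_zero (exp_ne_zero _), hlogq, ← exp_add, hD]
    congr 1; push_cast; ring
  have hpq : ‖(p : ℂ) - q‖ ^ 2 ≤ (1 - x ^ 2) * (1 - z ^ 2) := by
    rwa [hPe, hQe, ← mul_sub, norm_mul, norm_exp_ofReal_mul_I, one_mul] at h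
  rw [hγPe, hγQe, ← mul_sub, norm_mul, norm_exp_ofReal_mul_I, one_mul]
  set S : ℂ := (p : ℂ) ^ (γ : ℂ) - q ^ (γ : ℂ) with hS
  rcases eq_or_ne S 0 with hS0 | hS0
  · rw [hS0]; simpa using mul_pos hX hZ
  have hqs : q ∈ slitPlane := mem_slitPlane_iff_arg.2
    ⟨by rw [← log_im, hlogq]; exact hDu.ne, exp_ne_zero _⟩
  -- the segment from `q` to `p`
  let ω : ℝ → ℂ := fun t => q + t * (p - q)
  have hωs : ∀ t ∈ Icc (0 : ℝ) 1, ω t ∈ slitPlane := by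
    intro t ht
    rw [mem_slitPlane_iff] at hqs ⊢
    by_cases hi : q.im = 0
    · left
      have hr : 0 < q.re := by tauto
      have : (ω t).re = t * p + (1 - t) * q.re := by simp [ω]; ring
      rw [this]
      rcases eq_or_lt_of_le ht.1 with h0 | h0
      · rw [← h0]; simpa using hr
      · have := mul_pos h0 hp0
        have := mul_nonneg (sub_nonneg.2 ht.2) hr.le
        linarith
    · have him : (ω t).im = (1 - t) * q.im := by simp [ω]; ring
      have hre : (ω t).re = t * p + (1 - t) * q.re := by simp [ω]; ring
      rcases eq_or_lt_of_le ht.2 with h1 | h1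
      · left; rw [hre, h1]; simpa using hp0
      · right; rw [him]; exact mul_ne_zero (by linarith) hi
  have hωd : ∀ t : ℝ, HasDerivAt ω (p - q) t := by
    intro t
    have := ((hasDerivAt_id t).ofReal_comp.mul_const ((p : ℂ) - q)).const_add q
    simpa [ω] using this
  have hφd : ∀ t ∈ Icc (0 : ℝ) 1,
      HasDerivAt (fun t => ω t ^ (γ : ℂ)) (γ * ω t ^ ((γ : ℂ) - 1) * (p - q)) t := by
    intro t ht
    have := ((hasDerivAt_id (ω t)).cpow_const (c := (γ : ℂ)) (hωs t ht)).scomp t (hωd t)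
    simp only [id, mul_one, smul_eq_mul] at this
    rw [mul_comm] at this
    exact this
  -- the unimodular number that turns `S` into `‖S‖`
  let u : ℂ := (starRingEnd ℂ) S / ‖S‖
  have hSn : (‖S‖ : ℂ) ≠ 0 := by simpa using hS0
  have hu : ‖u‖ = 1 := by simp [u, hS0]
  have huS : (u * S).re = ‖S‖ := by
    have : u * S = (‖S‖ : ℂ) := by
      simp only [u]; rw [div_mul_eq_mul_div, conj_mul']; field_simp
    rw [this]; simp
  let A : ℝ → ℝ := fun t => x ^ 2 + t * (1 - x ^ 2)
  let C : ℝ → ℝ := fun t => z ^ 2 + t * (1 - z ^ 2)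
  have hA : ∀ t ∈ Icc (0 : ℝ) 1, 0 < A t := fun t ht => by
    have := mul_nonneg ht.1 (by linarith : 0 ≤ 1 - x ^ 2); simp only [A]; positivity
  have hC : ∀ t ∈ Icc (0 : ℝ) 1, 0 < C t := fun t ht => by
    have := mul_nonneg ht.1 (by linarith : 0 ≤ 1 - z ^ 2); simp only [C]; positivity
  -- the weight that balances the two increments `l (1 - x^{2γ})` and `l⁻¹ (1 - z^{2γ})`
  let l : ℝ := √(1 - (z ^ 2) ^ γ) / √(1 - (x ^ 2) ^ γ)
  have hsX := Real.sqrt_pos.2 hX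
  have hsZ := Real.sqrt_pos.2 hZ
  have hl : 0 < l := by positivity
  let g : ℝ → ℝ := fun t => 1 / 2 * (l * A t ^ γ + l⁻¹ * C t ^ γ) - (u * ω t ^ (γ : ℂ)).re
  have hgd : ∀ t ∈ Icc (0 : ℝ) 1, HasDerivAt g
      (1 / 2 * (l * ((1 - x ^ 2) * γ * A t ^ (γ - 1)) + l⁻¹ * ((1 - z ^ 2) * γ * C t ^ (γ - 1)))
        - (u * (γ * ω t ^ ((γ : ℂ) - 1) * (p - q))).re) t := by
    intro t ht
    have h1 : HasDerivAt A (1 - x ^ 2) t := by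
      have := ((hasDerivAt_id t).mul_const (1 - x ^ 2)).const_add (x ^ 2)
      rwa [one_mul] at this
    have h2 : HasDerivAt C (1 - z ^ 2) t := by
      have := ((hasDerivAt_id t).mul_const (1 - z ^ 2)).const_add (z ^ 2)
      rwa [one_mul] at this
    have h3 := h1.rpow_const (p := γ) (Or.inl (hA t ht).ne')
    have h4 := h2.rpow_const (p := γ) (Or.inl (hC t ht).ne')
    have h5 := (reCLM.hasFDerivAt.comp_hasDerivAt t ((hφd t ht).const_mul u))
    exact ((((h3.const_mul l).add (h4.const_mul l⁻¹)).const_mul (1 / 2)).sub h5)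
  have hmono : StrictMonoOn g (Icc 0 1) := by
    refine strictMonoOn_of_deriv_pos (convex_Icc 0 1)
      (fun t ht => (hgd t ht).continuousAt.continuousWithinAt) ?_
    intro t ht
    rw [interior_Icc] at ht
    have ht' : t ∈ Icc (0 : ℝ) 1 := ⟨ht.1.le, ht.2.le⟩
    rw [(hgd t ht').deriv, sub_pos]
    have hAt := hA t ht'
    have hCt := hC t ht'
    have hωn : ‖ω t‖ ^ 2 < A t * C t := by
      have h1 : ‖ω t‖ ≤ t * p + (1 - t) * (x * z) := by
        have : ω t = (t * p : ℝ) + ((1 - t : ℝ) : ℂ) * q := by simp [ω]; ring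
        rw [this]
        refine (norm_add_le _ _).trans ?_
        rw [norm_mul, hqn, norm_real, norm_real, Real.norm_of_nonneg (mul_pos ht.1 hp0).le,
          Real.norm_of_nonneg (by linarith [ht.2])]
      have h2 : ‖ω t‖ < t + (1 - t) * (x * z) := by
        have := mul_lt_mul_of_pos_left hp1 ht.1; linarith
      have h3 : (t + (1 - t) * (x * z)) ^ 2 ≤ A t * C t := by
        have := mul_nonneg (mul_nonneg ht.1.le (by linarith [ht.2] : 0 ≤ 1 - t)) (sq_nonneg (x - z))
        simp only [A, C]; nlinarith
      have := pow_lt_pow_left₀ h2 (norm_nonneg _) two_ne_zero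
      linarith
    have hω0 : 0 < ‖ω t‖ := norm_pos_iff.2 (slitPlane_ne_zero (hωs t ht'))
    have key := rpow_mul_lt_of_sq_lt hγ hl hAt hCt hω0
      (by linarith : 0 < 1 - x ^ 2) (by linarith : 0 < 1 - z ^ 2) hωn hpq
    calc (u * (γ * ω t ^ ((γ : ℂ) - 1) * (p - q))).re
        ≤ ‖u * (γ * ω t ^ ((γ : ℂ) - 1) * (p - q))‖ := re_le_norm _
      _ = γ * (‖ω t‖ ^ (γ - 1) * ‖(p : ℂ) - q‖) := by
          have : ((γ : ℂ) - 1) = ((γ - 1 : ℝ) : ℂ) := by push_cast; rfl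
          rw [norm_mul, hu, norm_mul, norm_mul, this, norm_cpow_real, norm_real,
            Real.norm_of_nonneg hγ0.le]; ring
      _ < _ := mul_lt_mul_of_pos_left key hγ0
      _ = _ := by ring
  have h01 := hmono (left_mem_Icc.2 zero_le_one) (right_mem_Icc.2 zero_le_one) zero_lt_one
  have hω0 : ω 0 = q := by simp [ω]
  have hω1 : ω 1 = p := by simp [ω]
  have hfin : ‖S‖ < √(1 - (x ^ 2) ^ γ) * √(1 - (z ^ 2) ^ γ) := by
    have e1 : A 1 = 1 := by simp [A]
    have e2 : C 1 = 1 := by simp [C]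
    have e3 : A 0 = x ^ 2 := by simp [A]
    have e4 : C 0 = z ^ 2 := by simp [C]
    simp only [g, hω0, hω1, e1, e2, e3, e4, Real.one_rpow] at h01
    rw [← huS, hS, mul_sub, sub_re]
    have e5 : l * (1 - (x ^ 2) ^ γ) = √(1 - (x ^ 2) ^ γ) * √(1 - (z ^ 2) ^ γ) := by
      simp only [l]; rw [div_mul_eq_mul_div, div_eq_iff hsX.ne']
      linear_combination -√(1 - (z ^ 2) ^ γ) * Real.mul_self_sqrt hX.le
    have e6 : l⁻¹ * (1 - (z ^ 2) ^ γ) = √(1 - (x ^ 2) ^ γ) * √(1 - (z ^ 2) ^ γ) := by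
      simp only [l]; rw [inv_div, div_mul_eq_mul_div, div_eq_iff hsZ.ne']
      linear_combination -√(1 - (x ^ 2) ^ γ) * Real.mul_self_sqrt hZ.le
    linarith
  calc ‖S‖ ^ 2 < (√(1 - (x ^ 2) ^ γ) * √(1 - (z ^ 2) ^ γ)) ^ 2 :=
        pow_lt_pow_left₀ hfin (norm_nonneg _) two_ne_zero
    _ = _ := by rw [mul_pow, Real.sq_sqrt hX.le, Real.sq_sqrt hZ.le]

section Hilbert

variable {E : Type*} [NormedAddCommGroup E] [InnerProductSpace ℂ E]

lemma inner_sub_proj (k v w : E) (hk : ‖k‖ = 1) :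
    inner ℂ (w - inner ℂ k w • k) (v - inner ℂ k v • k)
      = inner ℂ w v - inner ℂ w k * inner ℂ k v := by
  have h1 : inner ℂ k k = (1 : ℂ) := by rw [inner_self_eq_norm_sq_to_K, hk]; simp
  simp only [inner_sub_left, inner_sub_right, inner_smul_left, inner_smul_right, h1,
    inner_conj_symm]
  ring

lemma norm_sub_proj_sq (k v : E) (hk : ‖k‖ = 1) :
    ‖v - inner ℂ k v • k‖ ^ 2 = ‖v‖ ^ 2 - ‖inner ℂ k v‖ ^ 2 := by
  have h := inner_sub_proj k v v hk
  have h2 : inner ℂ v k * inner ℂ k v = ((‖inner ℂ k v‖ ^ 2 : ℝ) : ℂ) := by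
    rw [← inner_conj_symm, Complex.conj_mul']; push_cast; rfl
  rw [inner_self_eq_norm_sq_to_K, inner_self_eq_norm_sq_to_K, h2] at h
  have h' : ((‖v - inner ℂ k v • k‖ ^ 2 : ℝ) : ℂ) = ((‖v‖ ^ 2 - ‖inner ℂ k v‖ ^ 2 : ℝ) : ℂ) := by
    push_cast at h ⊢; exact h
  exact Complex.ofReal_injective h'

/-- The determinant of the Gram matrix of `k₁`, `k₂`, `v` is nonnegative: this is the
Cauchy-Schwarz inequality in the orthogonal complement of `k₁`. -/
lemma norm_inner_sub_sq_le (k₁ k₂ v : E) (h₁ : ‖k₁‖ = 1) (h₂ : ‖k₂‖ = 1) :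
    ‖inner ℂ k₂ v - inner ℂ k₂ k₁ * inner ℂ k₁ v‖ ^ 2
      ≤ (‖v‖ ^ 2 - ‖inner ℂ k₁ v‖ ^ 2) * (1 - ‖inner ℂ k₁ k₂‖ ^ 2) := by
  rw [← inner_sub_proj k₁ v k₂ h₁, ← norm_sub_proj_sq k₁ v h₁]
  have := norm_sub_proj_sq k₁ k₂ h₁
  rw [h₂, one_pow] at this
  rw [← this, ← mul_pow, mul_comm]
  exact pow_le_pow_left₀ (norm_nonneg _) (norm_inner_le_norm _ _) 2

/-- The determinant of the Gram matrix of `k₁`, `k₂`, `v` vanishes for `v` in the span of `k₁`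
and `k₂`. -/
lemma norm_sq_mul_eq_of_span (k₁ k₂ v : E) (a b : ℂ) (h₁ : ‖k₁‖ = 1) (h₂ : ‖k₂‖ = 1)
    (hv : v = a • k₁ + b • k₂) :
    (‖v‖ ^ 2 - ‖inner ℂ k₁ v‖ ^ 2) * (1 - ‖inner ℂ k₁ k₂‖ ^ 2)
      = ‖inner ℂ k₂ v - inner ℂ k₂ k₁ * inner ℂ k₁ v‖ ^ 2 := by
  have h11 : inner ℂ k₁ k₁ = (1 : ℂ) := by rw [inner_self_eq_norm_sq_to_K, h₁]; simp
  have hp : v - inner ℂ k₁ v • k₁ = b • (k₂ - inner ℂ k₁ k₂ • k₁) := by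
    rw [hv, inner_add_right, inner_smul_right, inner_smul_right, h11]
    module
  have h22 := norm_sub_proj_sq k₁ k₂ h₁
  rw [h₂, one_pow] at h22
  rw [← inner_sub_proj k₁ v k₂ h₁, ← norm_sub_proj_sq k₁ v h₁, ← h22, hp, inner_smul_right,
    norm_smul, norm_mul, inner_self_eq_norm_sq_to_K]
  simp; ring

end Hilbert

/-! ### The kernel and the argument of the zero-free factor -/

lemma mem_disc_iff {z : ℂ} : z ∈ disc ↔ ‖z‖ < 1 := by simp [disc]

lemma zero_mem_disc : (0 : ℂ) ∈ disc := by simp [disc]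

lemma isOpen_disc : IsOpen disc := Metric.isOpen_ball

lemma isPreconnected_disc : IsPreconnected disc := (convex_ball (0 : ℂ) 1).isPreconnected

lemma norm_mul_exp {r : ℝ} (hr : 0 ≤ r) (θ : ℝ) :
    ‖(r : ℂ) * Complex.exp (θ * Complex.I)‖ = r := by
  rw [norm_mul, Complex.norm_exp_ofReal_mul_I, Complex.norm_real, Real.norm_of_nonneg hr, mul_one]

lemma mul_exp_mem_disc {r : ℝ} (hr : r ∈ Ioo (0 : ℝ) 1) (θ : ℝ) :
    (r : ℂ) * Complex.exp (θ * Complex.I) ∈ disc := by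
  rw [mem_disc_iff, norm_mul_exp hr.1.le]; exact hr.2

lemma norm_conj_mul_lt_one {w z : ℂ} (hw : w ∈ disc) (hz : ‖z‖ ≤ 1) : ‖conj w * z‖ < 1 := by
  rw [mem_disc_iff] at hw
  rw [norm_mul, RCLike.norm_conj]
  exact (mul_le_of_le_one_right (norm_nonneg _) hz).trans_lt hw

lemma re_one_sub_pos {w z : ℂ} (hw : w ∈ disc) (hz : ‖z‖ ≤ 1) : 0 < (1 - conj w * z).re := by
  have := (Complex.re_le_norm (conj w * z)).trans_lt (norm_conj_mul_lt_one hw hz)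
  simp only [Complex.sub_re, Complex.one_re]
  linarith

/-- The holomorphic logarithm `log (1 - w̄ z)` of the reciprocal of the kernel `K_{w,1}`. -/
noncomputable def logDenom (w z : ℂ) : ℂ := Complex.log (1 - conj w * z)

lemma one_sub_mem_slitPlane {w z : ℂ} (hw : w ∈ disc) (hz : ‖z‖ ≤ 1) :
    1 - conj w * z ∈ Complex.slitPlane :=
  Or.inl (re_one_sub_pos hw hz)

lemma one_sub_ne_zero {w z : ℂ} (hw : w ∈ disc) (hz : ‖z‖ ≤ 1) : 1 - conj w * z ≠ 0 :=
  Complex.slitPlane_ne_zero (one_sub_mem_slitPlane hw hz)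

lemma exp_logDenom {w z : ℂ} (hw : w ∈ disc) (hz : ‖z‖ ≤ 1) :
    Complex.exp (logDenom w z) = 1 - conj w * z :=
  Complex.exp_log (one_sub_ne_zero hw hz)

lemma abs_im_logDenom_lt {w z : ℂ} (hw : w ∈ disc) (hz : ‖z‖ ≤ 1) :
    |(logDenom w z).im| < Real.pi / 2 := by
  rw [logDenom, Complex.log_im, Complex.abs_arg_lt_pi_div_two_iff]
  exact Or.inl (re_one_sub_pos hw hz)

lemma kernel_eq_exp {w z : ℂ} (hw : w ∈ disc) (hz : ‖z‖ ≤ 1) (a : ℝ) :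
    kernel w a z = Complex.exp (-(a * logDenom w z)) := by
  rw [kernel, Complex.cpow_def_of_ne_zero (one_sub_ne_zero hw hz), Complex.exp_neg, one_div,
    mul_comm, logDenom]

lemma continuousOn_logDenom {w : ℂ} (hw : w ∈ disc) :
    ContinuousOn (logDenom w) (Metric.closedBall 0 1) := by
  unfold logDenom
  refine ContinuousOn.clog (by fun_prop) fun z hz => one_sub_mem_slitPlane hw (by simpa using hz)

lemma differentiableOn_logDenom {w : ℂ} (hw : w ∈ disc) :
    DifferentiableOn ℂ (logDenom w) disc := by
  unfold logDenom
  refine DifferentiableOn.clog (by fun_prop) fun z hz =>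
    one_sub_mem_slitPlane hw (mem_disc_iff.1 hz).le

/-- If `exp ∘ Q` runs along a line in the plane, it does so without meeting the origin, hence
the argument changes by less than `π`. -/
lemma abs_im_sub_lt_pi_of_exp_eq_affine {Q : ℝ → ℂ} {ρ : ℝ → ℝ} {a b : ℝ} (hab : a ≤ b)
    (hQ : ContinuousOn Q (Icc a b)) (hρ : ContinuousOn ρ (Icc a b)) {A B : ℂ}
    (h : ∀ s ∈ Icc a b, Complex.exp (Q s) = A + B * ρ s) :
    |(Q b - Q a).im| < Real.pi := by
  by_contra! hcon
  have hV : ContinuousOn (fun s => |(Q s - Q a).im|) (Icc a b) :=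
    (Complex.continuous_im.comp_continuousOn (hQ.sub continuousOn_const)).abs
  obtain ⟨s, hs, hsV⟩ := intermediate_value_Icc hab hV
    (show Real.pi ∈ Icc _ _ from ⟨by simp [Real.pi_pos.le], hcon⟩)
  simp only at hsV
  -- at `s` the value of `exp ∘ Q` is a negative multiple of the initial value
  set m := Real.exp (Q s - Q a).re with hm
  have hm0 : 0 < m := Real.exp_pos _
  have h1 : Complex.exp (Q s - Q a) = -m := by
    rw [← Complex.re_add_im (Q s - Q a), Complex.exp_add, hm, ← Complex.ofReal_exp]
    rcases abs_eq Real.pi_pos.le |>.1 hsV with h | h <;> rw [h]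
    · simp
    · simp
  have ha : a ∈ Icc a b := left_mem_Icc.2 hab
  have h2 : A + B * ρ s = -m * (A + B * ρ a) := by
    rw [← h s hs, ← h a ha, ← h1, ← Complex.exp_add]; simp
  have h3 : (1 + m : ℂ) ≠ 0 := by exact_mod_cast (by positivity : (1 + m) ≠ 0)
  have h4 : A + B * (((ρ s + m * ρ a) / (1 + m) : ℝ) : ℂ) = 0 := by
    push_cast; field_simp; linear_combination h2
  have hsub : uIcc a s ⊆ Icc a b := by
    rw [uIcc_of_le hs.1]; exact Icc_subset_Icc_right hs.2
  have h5 : (ρ s + m * ρ a) / (1 + m) ∈ uIcc (ρ a) (ρ s) := by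
    rw [mem_uIcc, le_div_iff₀ (by positivity), le_div_iff₀ (by positivity),
      div_le_iff₀ (by positivity), div_le_iff₀ (by positivity)]
    rcases le_total (ρ a) (ρ s) with h | h
    · left; constructor <;> nlinarith
    · right; constructor <;> nlinarith
  obtain ⟨t, ht, htρ⟩ := intermediate_value_uIcc (hρ.mono hsub) h5
  have := h t (hsub ht)
  rw [htρ, h4] at this
  exact Complex.exp_ne_zero _ this

/-- The hyperbolic geodesic from `w₁` to `w₂`, parametrized so that
`(1 - w̄₁ z) / (1 - w̄₂ z)` runs along a ray. -/
lemma exists_geodesic {w₁ w₂ : ℂ} (hw₁ : w₁ ∈ disc) (hw₂ : w₂ ∈ disc) (hne : w₁ ≠ w₂) :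
    ∃ (R : ℝ) (u : ℂ) (ζ : ℝ → ℂ), 1 ≤ R ∧ ContinuousOn ζ (Icc 1 R) ∧
      (∀ r ∈ Icc 1 R, ζ r ∈ disc) ∧ ζ 1 = w₁ ∧ ζ R = w₂ ∧
      ∀ r ∈ Icc 1 R, 1 - conj w₁ * ζ r = r * u * (1 - conj w₂ * ζ r) := by
  have h₁ := mem_disc_iff.1 hw₁
  have h₂ := mem_disc_iff.1 hw₂
  set a : ℝ := 1 - Complex.normSq w₁ with ha
  set b : ℝ := 1 - Complex.normSq w₂ with hb
  set m : ℂ := 1 - conj w₂ * w₁ with hm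
  have ha0 : 0 < a := by rw [ha, Complex.normSq_eq_norm_sq]; nlinarith [norm_nonneg w₁]
  have hb0 : 0 < b := by rw [hb, Complex.normSq_eq_norm_sq]; nlinarith [norm_nonneg w₂]
  have hm0 : m ≠ 0 := one_sub_ne_zero hw₂ h₁.le
  have hd : 0 < Complex.normSq (w₁ - w₂) := Complex.normSq_pos.2 (sub_ne_zero.2 hne)
  have hmab : Complex.normSq m = a * b + Complex.normSq (w₁ - w₂) := by
    simp [ha, hb, hm, Complex.normSq_apply]; ring
  have hdc : conj w₁ - conj w₂ ≠ 0 := by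
    rw [← map_sub]; exact (map_ne_zero _).2 (sub_ne_zero.2 hne)
  have hac : (a : ℂ) = 1 - conj w₁ * w₁ := by
    rw [ha, ← Complex.normSq_eq_conj_mul_self]; push_cast; rfl
  have hbc : (b : ℂ) = 1 - conj w₂ * w₂ := by
    rw [hb, ← Complex.normSq_eq_conj_mul_self]; push_cast; rfl
  have hmc : (Complex.normSq m : ℂ) = (1 - conj w₁ * w₂) * m := by
    rw [Complex.normSq_eq_conj_mul_self, hm]; simp; ring_nf; simp
  have hb0' : (b : ℂ) ≠ 0 := by exact_mod_cast hb0.ne'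
  have ha0' : (a : ℂ) ≠ 0 := by exact_mod_cast ha0.ne'
  -- the quotient of the values of `(1 - w̄₁ z) / (1 - w̄₂ z)` at `w₂` and at `w₁`
  set R : ℝ := Complex.normSq m / (a * b) with hR
  have hR1 : 1 ≤ R := by rw [hR, one_le_div (by positivity), hmab]; linarith
  let N : ℝ → ℂ := fun r => m - r * a
  let D : ℝ → ℂ := fun r => conj w₁ * m - r * a * conj w₂
  have hND : ∀ r : ℝ, Complex.normSq (D r) - Complex.normSq (N r)
      = a * ((2 * r - 1) * Complex.normSq m - r ^ 2 * (a * b)) := by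
    intro r
    simp [N, D, ha, hb, hm, Complex.normSq_apply]; ring
  have hlt : ∀ r ∈ Icc 1 R, Complex.normSq (N r) < Complex.normSq (D r) := by
    intro r hr
    rw [← sub_pos, hND]
    refine mul_pos ha0 ?_
    have hr2 : r * (a * b) ≤ Complex.normSq m := by
      rw [← le_div_iff₀ (by positivity)]; exact hr.2
    have hab : 0 < a * b := by positivity
    have hr1 := hr.1
    rcases eq_or_lt_of_le hr1 with h | h
    · rw [← h]; linarith
    · have : 0 < Complex.normSq m := Complex.normSq_pos.2 hm0
      nlinarith [mul_le_mul_of_nonneg_left hr2 (by linarith : 0 ≤ r), mul_pos (sub_pos.2 h) this]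
  have hD0 : ∀ r ∈ Icc 1 R, D r ≠ 0 := fun r hr =>
    Complex.normSq_pos.1 ((Complex.normSq_nonneg _).trans_lt (hlt r hr))
  refine ⟨R, a / m, fun r => N r / D r, hR1, ?_, ?_, ?_, ?_, ?_⟩
  · exact ContinuousOn.div (by fun_prop) (by fun_prop) hD0
  · intro r hr
    have := hlt r hr
    rw [Complex.normSq_eq_norm_sq, Complex.normSq_eq_norm_sq] at this
    rw [mem_disc_iff, norm_div, div_lt_one (norm_pos_iff.2 (hD0 r hr))]
    exact lt_of_pow_lt_pow_left₀ 2 (norm_nonneg _) this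
  · have h1 := hD0 1 (left_mem_Icc.2 hR1)
    simp only
    rw [div_eq_iff h1]
    simp only [N, D, hac, hm]; push_cast; ring
  · have h1 := hD0 R (right_mem_Icc.2 hR1)
    simp only
    rw [div_eq_iff h1]
    have hRa : (R : ℂ) * a = (1 - conj w₁ * w₂) * m / b := by
      rw [← hmc, hR]; push_cast; field_simp
    simp only [N, D, hRa]
    field_simp
    rw [hbc]; ring
  · intro r hr
    have h1 := hD0 r hr
    simp only
    field_simp
    simp only [N, D]; ring

/-- The argument of `F^α (1 - w̄₁ z)^α`, for the branch `L` of `log F`, changes by less than `π`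
between the two nodes: along the geodesic joining them, this function runs along a line that misses
the origin. -/
lemma abs_im_lt_pi {L : ℂ → ℂ} (hL : DifferentiableOn ℂ L disc) {α : ℝ} {c₁ c₂ w₁ w₂ : ℂ}
    (hw₁ : w₁ ∈ disc) (hw₂ : w₂ ∈ disc) (hne : w₁ ≠ w₂)
    (h : ∀ z ∈ disc, Complex.exp (α * L z) = c₁ * kernel w₁ α z + c₂ * kernel w₂ α z) :
    |(α * (L w₂ + logDenom w₁ w₂ - (L w₁ + logDenom w₁ w₁))).im| < Real.pi := by
  obtain ⟨R, u, ζ, hR, hζc, hζd, hζ1, hζR, hζ⟩ := exists_geodesic hw₁ hw₂ hne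
  have h1 : (1 : ℝ) ∈ Icc 1 R := left_mem_Icc.2 hR
  have hn : ∀ r ∈ Icc 1 R, ‖ζ r‖ ≤ 1 := fun r hr => (mem_disc_iff.1 (hζd r hr)).le
  let d : ℝ → ℂ := fun r => logDenom w₁ (ζ r) - logDenom w₂ (ζ r)
  have hd : ∀ r ∈ Icc 1 R, d r = Real.log r + d 1 := by
    intro r hr
    have hr0 : 0 < r := by linarith [hr.1]
    have he : ∀ r ∈ Icc 1 R, Complex.exp (d r) = r * u := by
      intro r hr
      simp only [d]
      rw [Complex.exp_sub, exp_logDenom hw₁ (hn r hr), exp_logDenom hw₂ (hn r hr), hζ r hr,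
        mul_div_cancel_right₀ _ (one_sub_ne_zero hw₂ (hn r hr))]
    have hu : u ≠ 0 := by
      have := he 1 h1
      intro h0
      rw [h0, mul_zero] at this
      exact Complex.exp_ne_zero _ this
    have hexp : Complex.exp (d r - (Real.log r + d 1)) = 1 := by
      rw [Complex.exp_sub, Complex.exp_add, he r hr, he 1 h1, ← Complex.ofReal_exp,
        Real.exp_log hr0]
      have : (r : ℂ) ≠ 0 := by exact_mod_cast hr0.ne'
      push_cast; field_simp
    obtain ⟨n, hn'⟩ := Complex.exp_eq_one_iff.1 hexp
    have him : ∀ r ∈ Icc 1 R, |(d r).im| < Real.pi := by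
      intro r hr
      have h1 := abs_lt.1 (abs_im_logDenom_lt hw₁ (hn r hr))
      have h2 := abs_lt.1 (abs_im_logDenom_lt hw₂ (hn r hr))
      simp only [d, Complex.sub_im]
      rw [abs_lt]; constructor <;> linarith [h1.1, h1.2, h2.1, h2.2]
    have hi := congrArg Complex.im hn'
    simp at hi
    have ha := abs_lt.1 (him r hr)
    have hb := abs_lt.1 (him 1 h1)
    have hpi := Real.pi_pos
    -- both imaginary parts are below `π` in modulus, so that they differ by less than `2π`
    have hn0 : n = 0 := by
      have h3 : (n : ℝ) < 1 := by
        by_contra! hc; nlinarith [ha.1, ha.2, hb.1, hb.2]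
      have h4 : (-1 : ℝ) < n := by
        by_contra! hc; nlinarith [ha.1, ha.2, hb.1, hb.2]
      have h3' : n < 1 := by exact_mod_cast h3
      have h4' : -1 < n := by exact_mod_cast h4
      omega
    rw [hn0] at hn'
    simpa [sub_eq_zero] using hn'
  have hmaps : MapsTo ζ (Icc 1 R) disc := hζd
  have hQc : ContinuousOn (fun r => α * (L (ζ r) + logDenom w₁ (ζ r))) (Icc 1 R) :=
    ContinuousOn.mul continuousOn_const ((hL.continuousOn.comp hζc hmaps).add
      ((differentiableOn_logDenom hw₁).continuousOn.comp hζc hmaps))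
  have hρ : ContinuousOn (fun r : ℝ => Real.exp (α * Real.log r)) (Icc 1 R) := by
    refine Real.continuous_exp.comp_continuousOn (continuousOn_const.mul ?_)
    exact Real.continuousOn_log.mono fun r hr => by
      have : 1 ≤ r := hr.1
      simp; linarith
  have := abs_im_sub_lt_pi_of_exp_eq_affine hR hQc hρ (A := c₁)
    (B := c₂ * Complex.exp (α * d 1)) (fun r hr => by
      rw [mul_add, Complex.exp_add, h _ (hζd r hr), kernel_eq_exp hw₁ (hn r hr),
        kernel_eq_exp hw₂ (hn r hr), add_mul, mul_assoc, mul_assoc, ← Complex.exp_add,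
        ← Complex.exp_add, neg_add_cancel, Complex.exp_zero, mul_one, mul_assoc,
        Complex.ofReal_exp, ← Complex.exp_add]
      congr 3
      have := hd r hr
      simp only [d] at this ⊢
      push_cast
      linear_combination α * this)
  simp only [hζ1, hζR] at this
  rwa [← mul_sub] at this

/-! ### Taylor coefficients of the kernel and Parseval's identity -/

/-- The Taylor coefficients `Γ(n + β) / (n! Γ(β))` of `(1 - x)^{-β}`. -/
noncomputable def kernelCoeff (β : ℝ) (n : ℕ) : ℝ :=
  Real.Gamma (β + n) / (n.factorial * Real.Gamma β)

lemma kernelCoeff_pos {β : ℝ} (hβ : 0 < β) (n : ℕ) : 0 < kernelCoeff β n := by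
  have := Real.Gamma_pos_of_pos hβ
  have := Real.Gamma_pos_of_pos (by positivity : 0 < β + n)
  unfold kernelCoeff
  positivity

lemma kernelCoeff_one (n : ℕ) : kernelCoeff 1 n = 1 := by
  rw [kernelCoeff, add_comm, Real.Gamma_nat_eq_factorial, Real.Gamma_one, mul_one]
  exact div_self (by exact_mod_cast n.factorial_ne_zero)

lemma ofReal_kernelCoeff {β : ℝ} (hβ : 0 < β) (n : ℕ) :
    (kernelCoeff β n : ℂ) = Ring.choose ((β : ℂ) + n - 1) n := by
  have h1 := Ring.factorial_nsmul_multichoose_eq_ascPochhammer (β : ℂ) n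
  have h2 := Complex.Gamma_add_nat_div_Gamma_eq (n := n) (β : ℂ) (by
    intro m hm
    have := congrArg Complex.re hm
    simp at this
    have : (0 : ℝ) ≤ m := by positivity
    linarith)
  have h3 : Ring.choose ((β : ℂ) + n - 1) n = Ring.multichoose (β : ℂ) n := by
    rw [Ring.choose]; congr 1; ring
  have h4 : (n.factorial : ℂ) ≠ 0 := by exact_mod_cast n.factorial_ne_zero
  rw [Polynomial.ascPochhammer_smeval_eq_eval, ← h2, nsmul_eq_mul] at h1
  rw [h3, kernelCoeff]
  push_cast
  rw [← Complex.Gamma_ofReal, ← Complex.Gamma_ofReal]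
  push_cast
  rw [eq_comm, div_mul_eq_div_div_swap, eq_div_iff h4, mul_comm, h1]

lemma hasSum_kernel {β : ℝ} (hβ : 0 < β) {w z : ℂ} (hw : w ∈ disc) (hz : ‖z‖ ≤ 1) :
    HasSum (fun n => (kernelCoeff β n : ℂ) * (conj w * z) ^ n) (kernel w β z) := by
  have h := (Complex.one_div_one_sub_cpow_hasFPowerSeriesOnBall_zero (β : ℂ)).hasSum
    (y := conj w * z) (by
      have := norm_conj_mul_lt_one hw hz
      rw [Metric.mem_eball, edist_zero_right, ← ofReal_norm]
      exact ENNReal.ofReal_lt_one.2 this)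
  simpa [FormalMultilinearSeries.ofScalars_apply_eq, ofReal_kernelCoeff hβ, zero_add, kernel,
    mul_comm] using h

lemma integral_exp_int_mul {k : ℤ} (hk : k ≠ 0) (c : ℝ) :
    ∫ θ in Ioc c (c + 2 * Real.pi), Complex.exp (k * Complex.I * θ) = 0 := by
  have hk' : (k : ℂ) * Complex.I ≠ 0 := mul_ne_zero (by exact_mod_cast hk) Complex.I_ne_zero
  rw [← intervalIntegral.integral_of_le (by linarith [Real.pi_pos]), integral_exp_mul_complex hk']
  have : Complex.exp (k * Complex.I * ((c + 2 * Real.pi : ℝ) : ℂ))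
      = Complex.exp (k * Complex.I * c) := by
    rw [Complex.exp_eq_exp_iff_exists_int]
    exact ⟨k, by push_cast; ring⟩
  rw [this, sub_self, zero_div]

/-- Parseval's identity on the circle of radius `r`. -/
lemma hasSum_integral_circle {H : ℂ → ℂ} {a : ℕ → ℂ}
    (ha : ∀ z ∈ disc, HasSum (fun n => a n * z ^ n) (H z)) {r : ℝ} (hr0 : 0 ≤ r) (hr1 : r < 1)
    (c : ℝ) :
    HasSum (fun n => 2 * Real.pi * (‖a n‖ ^ 2 * (r ^ 2) ^ n))
      (∫ θ in Ioc c (c + 2 * Real.pi), ‖H (r * Complex.exp (θ * Complex.I))‖ ^ 2) := by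
  have hz : ∀ θ : ℝ, ‖(r : ℂ) * Complex.exp (θ * Complex.I)‖ = r :=
    norm_mul_exp hr0
  have hsum : Summable fun n => ‖a n‖ * r ^ n := by
    have := (ha r (by simpa [mem_disc_iff, abs_of_nonneg hr0] using hr1)).summable.norm
    simpa [abs_of_nonneg hr0] using this
  let g : ℕ → ℝ → ℂ := fun n θ => a n * ((r : ℂ) * Complex.exp (θ * Complex.I)) ^ n
  have hgn : ∀ n θ, ‖g n θ‖ = ‖a n‖ * r ^ n := fun n θ => by
    simp only [g]; rw [norm_mul, norm_pow, hz]
  have hgc : ∀ n, Continuous (g n) := fun n => by fun_prop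
  -- `|H|²` is expanded into a double series, of which only the diagonal survives integration
  let f : ℕ × ℕ → ℝ → ℂ := fun p θ => g p.1 θ * conj (g p.2 θ)
  have hfc : ∀ p, Continuous (f p) := fun p =>
    (hgc p.1).mul (Complex.continuous_conj.comp (hgc p.2))
  have hfn : ∀ p θ, ‖f p θ‖ = (‖a p.1‖ * r ^ p.1) * (‖a p.2‖ * r ^ p.2) := fun p θ => by
    simp only [f]; rw [norm_mul, RCLike.norm_conj, hgn, hgn]
  have hprod : Summable fun p : ℕ × ℕ => (‖a p.1‖ * r ^ p.1) * (‖a p.2‖ * r ^ p.2) :=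
    summable_mul_of_summable_norm hsum.norm hsum.norm
  have hpi : (0 : ℝ) ≤ 2 * Real.pi := by positivity
  have key := hasSum_integral_of_summable_integral_norm
    (μ := volume.restrict (Ioc c (c + 2 * Real.pi))) (F := f)
    (fun p => (hfc p).integrableOn_Ioc) (by
      simp only [hfn, integral_const, smul_eq_mul]
      exact hprod.mul_left _)
  have htsum : ∀ θ : ℝ, ∑' p, f p θ
      = ((‖H (r * Complex.exp (θ * Complex.I))‖ ^ 2 : ℝ) : ℂ) := by
    intro θ
    have h1 : HasSum (fun n => g n θ) (H (r * Complex.exp (θ * Complex.I))) :=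
      ha _ (by rw [mem_disc_iff, hz]; exact hr1)
    have h2 : HasSum (fun n => conj (g n θ)) (conj (H (r * Complex.exp (θ * Complex.I)))) :=
      Complex.hasSum_conj.2 (by simpa using h1)
    have h3 := h1.mul h2 (by
      refine summable_mul_of_summable_norm (f := fun n => g n θ) (g := fun n => conj (g n θ)) ?_ ?_
      · simpa [hgn] using hsum
      · simpa [hgn] using hsum)
    rw [h3.tsum_eq, Complex.mul_conj']
    push_cast; rfl
  have hint : ∀ p : ℕ × ℕ, ∫ θ in Ioc c (c + 2 * Real.pi), f p θ
      = if p.1 = p.2 then ((2 * Real.pi * (‖a p.1‖ ^ 2 * (r ^ 2) ^ p.1) : ℝ) : ℂ) else 0 := by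
    intro p
    have hfe : ∀ θ : ℝ, f p θ = a p.1 * conj (a p.2) * r ^ p.1 * r ^ p.2 *
        Complex.exp (((p.1 : ℤ) - (p.2 : ℤ) : ℤ) * Complex.I * θ) := by
      intro θ
      simp only [f, g]
      rw [mul_pow, ← Complex.exp_nat_mul, mul_pow, ← Complex.exp_nat_mul]
      simp only [map_mul, map_pow, ← Complex.exp_conj, Complex.conj_ofReal, Complex.conj_I,
        map_natCast]
      have : Complex.exp ((((p.1 : ℤ) - (p.2 : ℤ) : ℤ) : ℂ) * Complex.I * θ)
          = Complex.exp (p.1 * (θ * Complex.I)) * Complex.exp (p.2 * (θ * -Complex.I)) := by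
        rw [← Complex.exp_add]; congr 1; push_cast; ring
      rw [this]; ring
    simp only [hfe]
    split_ifs with h
    · rw [h]
      simp only [sub_self, Int.cast_zero, zero_mul, Complex.exp_zero, mul_one]
      rw [setIntegral_const, measureReal_def, Real.volume_Ioc, add_sub_cancel_left,
        ENNReal.toReal_ofReal hpi, Complex.mul_conj']
      push_cast
      simp; ring
    · rw [integral_const_mul, integral_exp_int_mul (by omega), mul_zero]
  simp only [htsum, hint] at key
  rw [integral_complex_ofReal] at key
  have hinj : Function.Injective fun n : ℕ => (n, n) := fun m n h => (Prod.mk.inj h).1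
  rw [← hinj.hasSum_iff (by
    intro p hp
    rw [if_neg]
    intro h
    exact hp ⟨p.1, Prod.ext rfl h⟩)] at key
  have : HasSum (fun n => ((2 * Real.pi * (‖a n‖ ^ 2 * (r ^ 2) ^ n) : ℝ) : ℂ))
      ((∫ θ in Ioc c (c + 2 * Real.pi), ‖H (r * Complex.exp (θ * Complex.I))‖ ^ 2 : ℝ) : ℂ) := by
    refine key.congr_fun fun n => ?_
    exact (if_pos rfl).symm
  exact_mod_cast this

lemma lintegral_circle {H : ℂ → ℂ} {a : ℕ → ℂ} (hH : ContinuousOn H disc)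
    (ha : ∀ z ∈ disc, HasSum (fun n => a n * z ^ n) (H z)) {r : ℝ} (hr0 : 0 ≤ r) (hr1 : r < 1)
    (c : ℝ) :
    ∫⁻ θ in Ioc c (c + 2 * Real.pi),
      ENNReal.ofReal (‖H (r * Complex.exp (θ * Complex.I))‖ ^ 2 / (2 * Real.pi))
      = ∑' n, ENNReal.ofReal (‖a n‖ ^ 2 * (r ^ 2) ^ n) := by
  have hpi : (0 : ℝ) < 2 * Real.pi := by positivity
  have h := (hasSum_integral_circle ha hr0 hr1 c).div_const (2 * Real.pi)
  have hc : Continuous fun θ : ℝ => ‖H (r * Complex.exp (θ * Complex.I))‖ ^ 2 / (2 * Real.pi) := by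
    have : Continuous fun θ : ℝ => H (r * Complex.exp (θ * Complex.I)) :=
      hH.comp_continuous (by fun_prop) fun θ => by
        rw [mem_disc_iff, norm_mul_exp hr0]
        exact hr1
    exact (this.norm.pow 2).div_const _
  rw [← ofReal_integral_eq_lintegral_ofReal hc.integrableOn_Ioc
    (Eventually.of_forall fun θ => by positivity), integral_div, ← h.tsum_eq,
    ENNReal.ofReal_tsum_of_nonneg (fun n => by positivity) h.summable]
  congr 1; ext n; congr 1
  field_simp

/-! ### Norms in terms of Taylor coefficients -/

/-- The radial moments are beta integrals, equal to the reciprocals of the coefficients of the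
kernel. -/
lemma lintegral_radial {β : ℝ} (hβ : 1 < β) (n : ℕ) :
    ∫⁻ r in Ioo (0 : ℝ) 1,
      ENNReal.ofReal (2 * r * ((β - 1) * (1 - r ^ 2) ^ (β - 2)) * (r ^ 2) ^ n)
      = ENNReal.ofReal (1 / kernelCoeff β n) := by
  have hβ1 : 0 < β - 1 := by linarith
  have hn : (0 : ℝ) < n + 1 := by positivity
  have hb := ProbabilityTheory.beta_pos hn hβ1
  have h1 := ProbabilityTheory.lintegral_betaPDF_eq_one hn hβ1
  rw [ProbabilityTheory.lintegral_betaPDF] at h1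
  have himg : (fun r : ℝ => r ^ 2) '' Ioo 0 1 = Ioo 0 1 := by
    ext x
    constructor
    · rintro ⟨r, hr, rfl⟩
      exact ⟨by have := hr.1; positivity, by have := hr.1; have := hr.2; simp only; nlinarith⟩
    · intro hx
      exact ⟨√x, ⟨Real.sqrt_pos.2 hx.1, by rw [Real.sqrt_lt' one_pos]; simpa using hx.2⟩,
        Real.sq_sqrt hx.1.le⟩
  rw [← himg, lintegral_image_eq_lintegral_abs_deriv_mul measurableSet_Ioo
    (f' := fun r => 2 * r) (fun r _ => by simpa using (hasDerivAt_pow 2 r).hasDerivWithinAt)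
    (fun x hx y hy h => by
      exact (pow_left_inj₀ hx.1.le hy.1.le two_ne_zero).1 h)] at h1
  have hc : (β - 1) * ProbabilityTheory.beta (n + 1) (β - 1) = 1 / kernelCoeff β n := by
    have hG := Real.Gamma_add_one hβ1.ne'
    rw [sub_add_cancel] at hG
    rw [ProbabilityTheory.beta, kernelCoeff, Real.Gamma_nat_eq_factorial, one_div_div, hG]
    rw [show (n : ℝ) + 1 + (β - 1) = β + n by ring]
    ring
  rw [← mul_one (ENNReal.ofReal (1 / kernelCoeff β n)), ← h1, ← lintegral_const_mul' _ _
    ENNReal.ofReal_ne_top]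
  refine setLIntegral_congr_fun measurableSet_Ioo fun r hr => ?_
  have hr0 := hr.1
  have hc0 := kernelCoeff_pos (by linarith : 0 < β) n
  rw [← hc, ← ENNReal.ofReal_mul (abs_nonneg _), ← ENNReal.ofReal_mul (by positivity)]
  congr 1
  rw [abs_of_pos (by positivity), add_sub_cancel_right, Real.rpow_natCast,
    show β - 1 - 1 = β - 2 by ring]
  field_simp

lemma lintegral_disc_polar {Φ : ℂ → ℝ≥0∞} (hΦ : Measurable Φ) :
    ∫⁻ z in disc, Φ z = ∫⁻ r in Ioo (0 : ℝ) 1, ENNReal.ofReal r *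
      ∫⁻ θ in Ioc (-Real.pi) (-Real.pi + 2 * Real.pi), Φ (r * Complex.exp (θ * Complex.I)) := by
  have hmd : MeasurableSet disc := isOpen_disc.measurableSet
  have hsymm : ∀ p : ℝ × ℝ, Complex.polarCoord.symm p = p.1 * Complex.exp (p.2 * Complex.I) := by
    intro p
    rw [Complex.polarCoord_symm_apply, Complex.exp_mul_I]; push_cast; rfl
  rw [← lintegral_indicator hmd, ← Complex.lintegral_comp_polarCoord_symm]
  simp only [hsymm, smul_eq_mul]
  have htgt : polarCoord.target = Ioi (0 : ℝ) ×ˢ Ioo (-Real.pi) Real.pi := rfl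
  have hmeas : Measurable fun p : ℝ × ℝ => ENNReal.ofReal p.1 *
      disc.indicator Φ (p.1 * Complex.exp (p.2 * Complex.I)) :=
    (by fun_prop : Measurable fun p : ℝ × ℝ => ENNReal.ofReal p.1).mul
      ((hΦ.indicator hmd).comp (by fun_prop))
  rw [htgt, Measure.volume_eq_prod, ← Measure.prod_restrict, lintegral_prod _ hmeas.aemeasurable]
  have hsub : Ioo (0 : ℝ) 1 ⊆ Ioi 0 := fun x hx => hx.1
  rw [← lintegral_indicator measurableSet_Ioi, ← lintegral_indicator measurableSet_Ioo]
  congr 1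
  ext r
  by_cases hr0 : r ∈ Ioi (0 : ℝ)
  · rw [indicator_of_mem hr0, lintegral_const_mul' _ _ ENNReal.ofReal_ne_top]
    have hn : ∀ θ : ℝ, ‖(r : ℂ) * Complex.exp (θ * Complex.I)‖ = r :=
      norm_mul_exp (mem_Ioi.1 hr0).le
    by_cases hr1 : r < 1
    · rw [indicator_of_mem (show r ∈ Ioo (0 : ℝ) 1 from ⟨hr0, hr1⟩)]
      congr 1
      rw [restrict_Ioo_eq_restrict_Ioc, show -Real.pi + 2 * Real.pi = Real.pi by ring]
      congr 1
      ext θ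
      rw [indicator_of_mem (mem_disc_iff.2 (by rw [hn]; exact hr1))]
    · rw [indicator_of_notMem (fun h => hr1 h.2)]
      have : ∀ θ : ℝ, disc.indicator Φ (r * Complex.exp (θ * Complex.I)) = 0 := fun θ =>
        indicator_of_notMem (fun h => hr1 (by rwa [mem_disc_iff, hn] at h)) _
      simp [this]
  · rw [indicator_of_notMem hr0, indicator_of_notMem (fun h => hr0 (hsub h))]

lemma lintegral_invariantMeasure (g : ℂ → ℝ≥0∞) :
    ∫⁻ z, g z ∂invariantMeasure
      = ∫⁻ z in disc, ENNReal.ofReal (((1 - ‖z‖ ^ 2) ^ 2)⁻¹ / Real.pi) * g z := by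
  rw [invariantMeasure, lintegral_withDensity_eq_lintegral_mul_non_measurable _ (by fun_prop)
    (Eventually.of_forall fun z => ENNReal.ofReal_lt_top)]
  rfl

/-- The squared norm of `A²_β`, `β > 1`, in terms of Taylor coefficients. -/
lemma lintegral_bergman {β : ℝ} (hβ : 1 < β) {H : ℂ → ℂ} {a : ℕ → ℂ} (hH : ContinuousOn H disc)
    (ha : ∀ z ∈ disc, HasSum (fun n => a n * z ^ n) (H z)) :
    ∫⁻ z, ENNReal.ofReal (‖H z‖ ^ 2 * (β - 1) * (1 - ‖z‖ ^ 2) ^ β) ∂invariantMeasure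
      = ∑' n, ENNReal.ofReal (‖a n‖ ^ 2 / kernelCoeff β n) := by
  have hmd : MeasurableSet disc := isOpen_disc.measurableSet
  have hpi := Real.pi_pos
  -- `H` is arbitrary outside the disc, so that only its truncation is known to be measurable
  have hHm : Measurable (disc.indicator H) := by
    classical
    rw [← piecewise_eq_indicator]
    exact hH.measurable_piecewise continuousOn_const hmd
  let Φ : ℂ → ℝ≥0∞ := fun z => ENNReal.ofReal (2 * ((β - 1) * (1 - ‖z‖ ^ 2) ^ (β - 2))) *
    ENNReal.ofReal (‖disc.indicator H z‖ ^ 2 / (2 * Real.pi))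
  have hΦ : Measurable Φ := by fun_prop
  have hinv : ∫⁻ z, ENNReal.ofReal (‖H z‖ ^ 2 * (β - 1) * (1 - ‖z‖ ^ 2) ^ β) ∂invariantMeasure
      = ∫⁻ z in disc, Φ z := by
    rw [lintegral_invariantMeasure]
    refine setLIntegral_congr_fun hmd fun z hz => ?_
    have h1 : 0 < 1 - ‖z‖ ^ 2 := by nlinarith [mem_disc_iff.1 hz, norm_nonneg z]
    have hβ1 : 0 < β - 1 := by linarith
    simp only [Φ]
    rw [← ENNReal.ofReal_mul (by positivity), ← ENNReal.ofReal_mul (by positivity),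
      indicator_of_mem hz, Real.rpow_sub h1, Real.rpow_two]
    congr 1
    field_simp
  rw [hinv, lintegral_disc_polar hΦ]
  have hr : ∀ r ∈ Ioo (0 : ℝ) 1, ENNReal.ofReal r *
      ∫⁻ θ in Ioc (-Real.pi) (-Real.pi + 2 * Real.pi), Φ (r * Complex.exp (θ * Complex.I))
      = ∑' n, ENNReal.ofReal (‖a n‖ ^ 2) * ENNReal.ofReal
        (2 * r * ((β - 1) * (1 - r ^ 2) ^ (β - 2)) * (r ^ 2) ^ n) := by
    intro r hr
    have hn : ∀ θ : ℝ, ‖(r : ℂ) * Complex.exp (θ * Complex.I)‖ = r :=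
      norm_mul_exp hr.1.le
    have hi : ∀ θ : ℝ, disc.indicator H (r * Complex.exp (θ * Complex.I))
        = H (r * Complex.exp (θ * Complex.I)) := fun θ =>
      indicator_of_mem (mul_exp_mem_disc hr θ) _
    have hr0 := hr.1
    have h1 : 0 < 1 - r ^ 2 := by nlinarith [hr.2]
    have hβ1 : 0 < β - 1 := by linarith
    simp only [Φ, hn, hi]
    rw [lintegral_const_mul' _ _ ENNReal.ofReal_ne_top, lintegral_circle hH ha hr.1.le hr.2,
      ← mul_assoc, ← ENNReal.ofReal_mul hr.1.le, ← ENNReal.tsum_mul_left]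
    congr 1
    ext n
    rw [← ENNReal.ofReal_mul (by positivity), ← ENNReal.ofReal_mul (by positivity)]
    congr 1
    ring
  rw [setLIntegral_congr_fun measurableSet_Ioo hr, lintegral_tsum (fun n => by fun_prop)]
  congr 1
  ext n
  rw [lintegral_const_mul' _ _ ENNReal.ofReal_ne_top, lintegral_radial hβ,
    ← ENNReal.ofReal_mul (by positivity), mul_one_div]

lemma iSup_tsum_radial (a : ℕ → ℂ) :
    ⨆ r ∈ Ioo (0 : ℝ) 1, ∑' n, ENNReal.ofReal (‖a n‖ ^ 2 * (r ^ 2) ^ n)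
      = ∑' n, ENNReal.ofReal (‖a n‖ ^ 2) := by
  refine le_antisymm (iSup₂_le fun r hr => ENNReal.tsum_le_tsum fun n => ?_) ?_
  · refine ENNReal.ofReal_le_ofReal (mul_le_of_le_one_right (by positivity) ?_)
    exact pow_le_one₀ (by positivity) (pow_le_one₀ hr.1.le hr.2.le)
  · rw [ENNReal.tsum_eq_iSup_sum]
    refine iSup_le fun s => ?_
    have ht : Tendsto (fun r : ℝ => ∑ n ∈ s, ENNReal.ofReal (‖a n‖ ^ 2 * (r ^ 2) ^ n)) (𝓝[<] 1)
        (𝓝 (∑ n ∈ s, ENNReal.ofReal (‖a n‖ ^ 2))) := by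
      have : Continuous fun r : ℝ => ∑ n ∈ s, ENNReal.ofReal (‖a n‖ ^ 2 * (r ^ 2) ^ n) :=
        continuous_finsetSum _ fun n _ => ENNReal.continuous_ofReal.comp (by fun_prop)
      simpa using (this.tendsto 1).mono_left nhdsWithin_le_nhds
    refine le_of_tendsto ht ?_
    filter_upwards [Ioo_mem_nhdsLT (zero_lt_one' ℝ)] with r hr
    exact (ENNReal.sum_le_tsum s).trans
      (le_iSup₂ (f := fun (r : ℝ) (_ : r ∈ Ioo (0 : ℝ) 1) =>
        ∑' n, ENNReal.ofReal (‖a n‖ ^ 2 * (r ^ 2) ^ n)) r hr)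

/-- The integral mean `∫ |f(re^{iθ})|² dθ / 2π` of the Hardy norm. -/
noncomputable def circleMean (f : ℂ → ℂ) (r : ℝ) : ℝ≥0∞ :=
  ∫⁻ θ in Ioc (0 : ℝ) (2 * Real.pi),
    ENNReal.ofReal (‖f (r * Complex.exp (θ * Complex.I))‖ ^ 2 / (2 * Real.pi))

lemma hardyNorm_two (f : ℂ → ℂ) :
    hardyNorm 2 f = (⨆ r ∈ Ioo (0 : ℝ) 1, circleMean f r) ^ (1 / 2 : ℝ) := by
  have := (ENNReal.orderIsoRpow (1 / 2) (by norm_num)).map_iSup₂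
    (fun (r : ℝ) (_ : r ∈ Ioo (0 : ℝ) 1) => circleMean f r)
  simp only [ENNReal.orderIsoRpow_apply] at this
  rw [this, hardyNorm]
  simp only [circleMean, Real.rpow_two]

lemma circleMean_eq {H : ℂ → ℂ} {a : ℕ → ℂ} (hH : ContinuousOn H disc)
    (ha : ∀ z ∈ disc, HasSum (fun n => a n * z ^ n) (H z)) {r : ℝ} (hr : r ∈ Ioo (0 : ℝ) 1) :
    circleMean H r = ∑' n, ENNReal.ofReal (‖a n‖ ^ 2 * (r ^ 2) ^ n) := by
  have := lintegral_circle hH ha hr.1.le hr.2 0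
  rwa [zero_add] at this

/-- The squared norm in `A²_β`, `β ≥ 1`, of the power series with coefficients `a`. -/
noncomputable def coeffNormSq (β : ℝ) (a : ℕ → ℂ) : ℝ≥0∞ :=
  ∑' n, ENNReal.ofReal (‖a n‖ ^ 2 / kernelCoeff β n)

/-- The norm of `A^{2β}_β` of `F = e^L` is read off the Taylor coefficients of `e^{βL}`. -/
lemma bergmanNorm_eq {β : ℝ} (hβ : 1 ≤ β) {F L : ℂ → ℂ} (hL : DifferentiableOn ℂ L disc)
    (hF : ∀ z ∈ disc, F z = Complex.exp (L z)) {a : ℕ → ℂ}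
    (ha : ∀ z ∈ disc, HasSum (fun n => a n * z ^ n) (Complex.exp (β * L z))) :
    bergmanNorm β (2 * β) F = (coeffNormSq β a) ^ (1 / (2 * β)) := by
  have hcont : ContinuousOn (fun z => Complex.exp (β * L z)) disc :=
    (continuousOn_const.mul hL.continuousOn).cexp
  rcases eq_or_lt_of_le hβ with rfl | hβ1
  · rw [bergmanNorm, if_pos rfl, mul_one, hardyNorm_two]
    congr 1
    rw [coeffNormSq]
    simp only [kernelCoeff_one, div_one]
    rw [← iSup_tsum_radial]
    refine iSup_congr fun r => iSup_congr fun hr => ?_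
    rw [← circleMean_eq hcont ha hr, circleMean, circleMean]
    congr 1; ext θ
    rw [hF _ (mul_exp_mem_disc hr θ), Complex.ofReal_one, one_mul]
  · rw [bergmanNorm, if_neg hβ1.ne']
    congr 1
    rw [coeffNormSq, ← lintegral_bergman hβ1 hcont ha, lintegral_invariantMeasure,
      lintegral_invariantMeasure]
    refine setLIntegral_congr_fun isOpen_disc.measurableSet fun z hz => ?_
    rw [hF z hz, Complex.norm_exp, Complex.norm_exp, ← Real.exp_mul, ← Real.exp_nat_mul]
    congr 5
    simp
    ring

/-- Taylor expansion on the disc. -/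
lemma exists_hasSum {H : ℂ → ℂ} (hH : DifferentiableOn ℂ H disc) :
    ∃ a : ℕ → ℂ, ∀ z ∈ disc, HasSum (fun n => a n * z ^ n) (H z) := by
  refine ⟨fun n => ((n.factorial : ℂ))⁻¹ * iteratedDeriv n H 0, fun z hz => ?_⟩
  have := Complex.hasSum_taylorSeries_on_ball hH hz
  simpa [mul_comm, mul_assoc, mul_left_comm] using this

/-! ### The reproducing kernel Hilbert spaces and the strict inequality -/

/-- The Hilbert space `ℓ²` in which `A²_β` is modelled: `v` stands for the function with Taylor
coefficients `√(kernelCoeff β n) * v n`. -/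
noncomputable abbrev SeqSpace := lp (fun _ : ℕ => ℂ) 2

lemma memℓp_two_iff {f : ℕ → ℂ} : Memℓp f 2 ↔ Summable fun n => ‖f n‖ ^ 2 := by
  rw [memℓp_gen_iff (by norm_num)]
  simp

lemma norm_sq_seqSpace (v : SeqSpace) : HasSum (fun n => ‖v n‖ ^ 2) (‖v‖ ^ 2) := by
  have := lp.hasSum_norm (by norm_num : 0 < (2 : ℝ≥0∞).toReal) v
  simpa using this

lemma coeffNormSq_seqSpace {β : ℝ} (hβ : 0 < β) (v : SeqSpace) :
    coeffNormSq β (fun n => √(kernelCoeff β n) * v n) = ENNReal.ofReal (‖v‖ ^ 2) := by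
  rw [coeffNormSq, ← (norm_sq_seqSpace v).tsum_eq,
    ENNReal.ofReal_tsum_of_nonneg (fun n => by positivity) (norm_sq_seqSpace v).summable]
  congr 1; ext n; congr 1
  have := kernelCoeff_pos hβ n
  rw [norm_mul, mul_pow, Complex.norm_real, Real.norm_of_nonneg (Real.sqrt_nonneg _),
    Real.sq_sqrt this.le]
  field_simp

lemma exists_seqSpace {β : ℝ} (hβ : 0 < β) {a : ℕ → ℂ} (h : coeffNormSq β a ≠ ∞) :
    ∃ v : SeqSpace, ∀ n, a n = √(kernelCoeff β n) * v n := by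
  have hc := kernelCoeff_pos hβ
  have hmem : Memℓp (fun n => a n / (√(kernelCoeff β n) : ℂ)) 2 := by
    rw [memℓp_two_iff]
    have := ENNReal.summable_toReal h
    refine this.congr fun n => ?_
    have := hc n
    rw [ENNReal.toReal_ofReal (by positivity), norm_div, div_pow, Complex.norm_real,
      Real.norm_of_nonneg (Real.sqrt_nonneg _), Real.sq_sqrt this.le]
  refine ⟨⟨_, hmem⟩, fun n => ?_⟩
  have : (√(kernelCoeff β n) : ℂ) ≠ 0 := by exact_mod_cast (Real.sqrt_pos.2 (hc n)).ne'
  simp only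
  field_simp

lemma memℓp_kernel {β : ℝ} (hβ : 0 < β) {w : ℂ} (hw : w ∈ disc) :
    Memℓp (fun n => (√(kernelCoeff β n) : ℂ) * conj w ^ n) 2 := by
  rw [memℓp_two_iff]
  refine (hasSum_kernel hβ hw (mem_disc_iff.1 hw).le).summable.norm.congr fun n => ?_
  have := kernelCoeff_pos hβ n
  rw [mul_pow, norm_mul, norm_mul, norm_mul, norm_pow, norm_pow, mul_pow, Complex.norm_real,
    Complex.norm_real, Real.norm_of_nonneg (Real.sqrt_nonneg _), Real.sq_sqrt this.le,
    Real.norm_of_nonneg this.le, RCLike.norm_conj]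
  ring

/-- The reproducing kernel of `A²_β` at `w`, as a vector of `ℓ²`. -/
noncomputable def kernelVec {β : ℝ} (hβ : 0 < β) {w : ℂ} (hw : w ∈ disc) : SeqSpace :=
  ⟨fun n => (√(kernelCoeff β n) : ℂ) * conj w ^ n, memℓp_kernel hβ hw⟩

lemma kernelVec_apply {β : ℝ} (hβ : 0 < β) {w : ℂ} (hw : w ∈ disc) (n : ℕ) :
    kernelVec hβ hw n = (√(kernelCoeff β n) : ℂ) * conj w ^ n := rfl

/-- The reproducing property. -/
lemma hasSum_inner_kernelVec {β : ℝ} (hβ : 0 < β) {w : ℂ} (hw : w ∈ disc) (v : SeqSpace) :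
    HasSum (fun n => (√(kernelCoeff β n) * v n) * w ^ n) (inner ℂ (kernelVec hβ hw) v) := by
  refine (lp.hasSum_inner (𝕜 := ℂ) (kernelVec hβ hw) v).congr_fun fun n => ?_
  rw [kernelVec_apply, RCLike.inner_apply]
  simp
  ring

lemma sqrt_mul_kernelVec {β : ℝ} (hβ : 0 < β) {w : ℂ} (hw : w ∈ disc) (n : ℕ) :
    √(kernelCoeff β n) * kernelVec hβ hw n = (kernelCoeff β n : ℂ) * conj w ^ n := by
  rw [kernelVec_apply, ← mul_assoc, ← Complex.ofReal_mul,
    Real.mul_self_sqrt (kernelCoeff_pos hβ n).le]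

lemma inner_kernelVec {β : ℝ} (hβ : 0 < β) {w z : ℂ} (hw : w ∈ disc) (hz : z ∈ disc) :
    inner ℂ (kernelVec hβ hz) (kernelVec hβ hw) = kernel w β z := by
  refine (hasSum_inner_kernelVec hβ hz (kernelVec hβ hw)).unique ?_
  refine (hasSum_kernel hβ hw (mem_disc_iff.1 hz).le).congr_fun fun n => ?_
  rw [sqrt_mul_kernelVec, mul_pow]; ring

/-- Half of `log (1 - |w|²)`, the logarithm of the norming factor of the kernel at `w`. -/
noncomputable def halfLog (w : ℂ) : ℝ := Real.log (1 - ‖w‖ ^ 2) / 2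

lemma logDenom_self {w : ℂ} (hw : w ∈ disc) : logDenom w w = (2 * halfLog w : ℝ) := by
  have h1 : 0 < 1 - ‖w‖ ^ 2 := by nlinarith [mem_disc_iff.1 hw, norm_nonneg w]
  rw [logDenom, halfLog, Complex.conj_mul', mul_div_cancel₀ _ (two_ne_zero' ℝ),
    Complex.ofReal_log h1.le]
  push_cast; rfl

lemma norm_kernelVec {β : ℝ} (hβ : 0 < β) {w : ℂ} (hw : w ∈ disc) :
    ‖kernelVec hβ hw‖ = Real.exp (-(β * halfLog w)) := by
  have h := inner_kernelVec hβ hw hw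
  rw [inner_self_eq_norm_sq_to_K, kernel_eq_exp hw (mem_disc_iff.1 hw).le, logDenom_self hw,
    ← Complex.ofReal_mul, ← Complex.ofReal_neg, ← Complex.ofReal_exp] at h
  have h' : ‖kernelVec hβ hw‖ ^ 2 = Real.exp (-(β * (2 * halfLog w))) := by
    apply Complex.ofReal_injective
    push_cast at h ⊢
    exact h
  rw [← pow_left_inj₀ (norm_nonneg _) (Real.exp_pos _).le two_ne_zero, h', ← Real.exp_nat_mul]
  congr 1; push_cast; ring

/-- The normalized reproducing kernel. -/
noncomputable def unitKernel {β : ℝ} (hβ : 0 < β) {w : ℂ} (hw : w ∈ disc) : SeqSpace :=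
  (Real.exp (β * halfLog w) : ℂ) • kernelVec hβ hw

lemma norm_unitKernel {β : ℝ} (hβ : 0 < β) {w : ℂ} (hw : w ∈ disc) :
    ‖unitKernel hβ hw‖ = 1 := by
  rw [unitKernel, norm_smul, norm_kernelVec, Complex.norm_real,
    Real.norm_of_nonneg (Real.exp_pos _).le, ← Real.exp_add, add_neg_cancel, Real.exp_zero]

lemma inner_unitKernel_left {β : ℝ} (hβ : 0 < β) {w : ℂ} (hw : w ∈ disc) (v : SeqSpace) :
    inner ℂ (unitKernel hβ hw) v
      = Complex.exp (β * halfLog w) * inner ℂ (kernelVec hβ hw) v := by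
  rw [unitKernel, inner_smul_left, Complex.conj_ofReal]
  push_cast; rfl

lemma inner_unitKernel {β : ℝ} (hβ : 0 < β) {w z : ℂ} (hw : w ∈ disc) (hz : z ∈ disc) :
    inner ℂ (unitKernel hβ hz) (unitKernel hβ hw)
      = Complex.exp (β * (halfLog w + halfLog z - logDenom w z)) := by
  rw [inner_unitKernel_left, unitKernel, inner_smul_right, inner_kernelVec,
    kernel_eq_exp hw (mem_disc_iff.1 hz).le]
  push_cast
  rw [← Complex.exp_add, ← Complex.exp_add]
  congr 1; ring

/-- A unit vector that has inner product of modulus one with a normalized kernel is a multiple of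
that kernel. -/
lemma eq_smul_kernelVec {β : ℝ} (hβ : 0 < β) {w : ℂ} (hw : w ∈ disc) {v : SeqSpace}
    (hv : ‖v‖ = 1) (h : ‖inner ℂ (unitKernel hβ hw) v‖ = 1) :
    ∃ c : ℂ, v = c • kernelVec hβ hw := by
  have hk := norm_unitKernel hβ hw
  have h0 : unitKernel hβ hw ≠ 0 := by rw [← norm_ne_zero_iff, hk]; exact one_ne_zero
  have h1 : v ≠ 0 := by rw [← norm_ne_zero_iff, hv]; exact one_ne_zero
  obtain ⟨r, -, hr⟩ := (norm_inner_eq_norm_iff (𝕜 := ℂ) h0 h1).1 (by rw [h, hk, hv, one_mul])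
  exact ⟨_, by rw [hr, unitKernel, smul_smul]⟩

/-- Kernels at different points are linearly independent. -/
lemma norm_inner_unitKernel_lt_one {β : ℝ} (hβ : 0 < β) {w z : ℂ} (hw : w ∈ disc)
    (hz : z ∈ disc) (hne : w ≠ z) :
    ‖inner ℂ (unitKernel hβ hw) (unitKernel hβ hz)‖ < 1 := by
  refine lt_of_le_of_ne ((norm_inner_le_norm _ _).trans_eq ?_) fun h => hne ?_
  · rw [norm_unitKernel, norm_unitKernel, one_mul]
  obtain ⟨c, hc⟩ := eq_smul_kernelVec hβ hw (norm_unitKernel hβ hz) h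
  have h' : ∀ n, (Real.exp (β * halfLog z) : ℂ) * ((√(kernelCoeff β n) : ℂ) * conj z ^ n)
      = c * ((√(kernelCoeff β n) : ℂ) * conj w ^ n) := fun n => by
    have := congrArg (fun v : SeqSpace => v n) hc
    simpa [unitKernel, kernelVec_apply] using this
  have hs : ∀ n, (√(kernelCoeff β n) : ℂ) ≠ 0 := fun n => by
    exact_mod_cast (Real.sqrt_pos.2 (kernelCoeff_pos hβ n)).ne'
  have h0 : (Real.exp (β * halfLog z) : ℂ) = c := by
    have := h' 0
    simpa [hs 0] using this
  have h1 := h' 1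
  have hc0 : c ≠ 0 := by rw [← h0]; exact_mod_cast (Real.exp_pos _).ne'
  rw [h0] at h1
  have := mul_left_cancel₀ (hs 1) (mul_left_cancel₀ hc0 h1)
  simp only [pow_one] at this
  exact ((starRingEnd ℂ).injective this).symm

lemma eqOn_const_of_exp_eq {g : ℂ → ℂ} (hg : DifferentiableOn ℂ g disc) {c : ℂ}
    (h : ∀ z ∈ disc, Complex.exp (g z) = c) : ∀ z ∈ disc, g z = g 0 := by
  have hd : EqOn (deriv g) 0 disc := by
    intro z hz
    have h1 := (hg.differentiableAt (isOpen_disc.mem_nhds hz)).hasDerivAt.cexp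
    have h2 : HasDerivAt (fun z => Complex.exp (g z)) 0 z := by
      refine (hasDerivAt_const z c).congr_of_eventuallyEq ?_
      filter_upwards [isOpen_disc.mem_nhds hz] with y hy using h y hy
    simpa [Complex.exp_ne_zero] using h1.unique h2
  intro z hz
  exact isOpen_disc.is_const_of_deriv_eq_zero isPreconnected_disc hg hd hz zero_mem_disc

/-- If one power of `e^L` is a multiple of a kernel, then `L` itself is known up to a constant, and
so are all other powers. -/
lemma exists_log_eq_of_exp_eq_kernel {L : ℂ → ℂ} (hL : DifferentiableOn ℂ L disc) {β : ℝ}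
    (hβ : 0 < β) {c w : ℂ} (hw : w ∈ disc)
    (h : ∀ z ∈ disc, Complex.exp (β * L z) = c * kernel w β z) :
    ∃ κ : ℂ, ∀ z ∈ disc, L z = κ - logDenom w z := by
  have hg : DifferentiableOn ℂ (fun z => (β : ℂ) * (L z + logDenom w z)) disc :=
    (hL.add (differentiableOn_logDenom hw)).const_mul _
  have := eqOn_const_of_exp_eq hg (c := c) fun z hz => by
    rw [mul_add, Complex.exp_add, h z hz, kernel_eq_exp hw (mem_disc_iff.1 hz).le, mul_assoc,
      ← Complex.exp_add, neg_add_cancel, Complex.exp_zero, mul_one]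
  have hβ' : (β : ℂ) ≠ 0 := by exact_mod_cast hβ.ne'
  refine ⟨L 0 + logDenom w 0, fun z hz => ?_⟩
  have := mul_left_cancel₀ hβ' (this z hz)
  rw [← this]; ring

lemma exp_eq_kernel_of_log_eq {L : ℂ → ℂ} {κ w : ℂ} (hw : w ∈ disc)
    (h : ∀ z ∈ disc, L z = κ - logDenom w z) (β : ℝ) {z : ℂ} (hz : z ∈ disc) :
    Complex.exp (β * L z) = Complex.exp (β * κ) * kernel w β z := by
  rw [h z hz, kernel_eq_exp hw (mem_disc_iff.1 hz).le, ← Complex.exp_add]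
  congr 1; ring

/-- The norm in terms of a vector of `ℓ²`. -/
lemma bergmanNorm_eq_of_seqSpace {β : ℝ} (hβ : 1 ≤ β) {F L : ℂ → ℂ}
    (hL : DifferentiableOn ℂ L disc) (hF : ∀ z ∈ disc, F z = Complex.exp (L z)) {v : SeqSpace}
    (hv : ∀ z, ∀ hz : z ∈ disc,
      inner ℂ (kernelVec (zero_lt_one.trans_le hβ) hz) v = Complex.exp (β * L z)) :
    bergmanNorm β (2 * β) F = ENNReal.ofReal (‖v‖ ^ (1 / β)) := by
  have hβ0 := zero_lt_one.trans_le hβ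
  rw [bergmanNorm_eq hβ hL hF (a := fun n => √(kernelCoeff β n) * v n)
    (fun z hz => by rw [← hv z hz]; exact hasSum_inner_kernelVec hβ0 hz v),
    coeffNormSq_seqSpace hβ0, ENNReal.ofReal_rpow_of_nonneg (by positivity) (by positivity),
    ← Real.rpow_natCast, ← Real.rpow_mul (norm_nonneg _)]
  congr 2
  push_cast
  field_simp

/-- Multiples of a kernel have the same norm in all the spaces `A^{2β}_β`. -/
lemma bergmanNorm_of_log_eq {β : ℝ} (hβ : 1 ≤ β) {F L : ℂ → ℂ}
    (hL : DifferentiableOn ℂ L disc) (hF : ∀ z ∈ disc, F z = Complex.exp (L z)) {κ w : ℂ}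
    (hw : w ∈ disc) (h : ∀ z ∈ disc, L z = κ - logDenom w z) :
    bergmanNorm β (2 * β) F = ENNReal.ofReal (Real.exp (κ.re - halfLog w)) := by
  have hβ0 := zero_lt_one.trans_le hβ
  rw [bergmanNorm_eq_of_seqSpace hβ hL hF (v := Complex.exp (β * κ) • kernelVec hβ0 hw)
    (fun z hz => by rw [inner_smul_right, inner_kernelVec, exp_eq_kernel_of_log_eq hw h β hz]),
    norm_smul, norm_kernelVec, Complex.norm_exp, ← Real.exp_add, ← Real.exp_mul]
  congr 2
  simp
  field_simp
  ring

/-- For zero-free `F` whose power `F^α` is a combination of two kernels but not a multiple of one,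
the norms are strictly ordered. -/
lemma bergmanNorm_lt {F L : ℂ → ℂ} (hL : DifferentiableOn ℂ L disc)
    (hF : ∀ z ∈ disc, F z = Complex.exp (L z)) {α β : ℝ} (hβ : 1 ≤ β) (hβα : β < α)
    {c₁ c₂ w₁ w₂ : ℂ} (hw₁ : w₁ ∈ disc) (hw₂ : w₂ ∈ disc)
    (h : ∀ z ∈ disc, Complex.exp (α * L z) = c₁ * kernel w₁ α z + c₂ * kernel w₂ α z)
    (hns : ¬ ∃ κ w : ℂ, w ∈ disc ∧ ∀ z ∈ disc, L z = κ - logDenom w z) :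
    bergmanNorm α (2 * α) F < bergmanNorm β (2 * β) F := by
  have hβ0 : 0 < β := by linarith
  have hα0 : 0 < α := by linarith
  have hne : w₁ ≠ w₂ := by
    rintro rfl
    obtain ⟨κ, hκ⟩ := exists_log_eq_of_exp_eq_kernel hL hα0 (c := c₁ + c₂) hw₁
      fun z hz => by rw [h z hz]; ring
    exact hns ⟨κ, w₁, hw₁, hκ⟩
  let u : SeqSpace := c₁ • kernelVec hα0 hw₁ + c₂ • kernelVec hα0 hw₂
  have hu : ∀ z, ∀ hz : z ∈ disc, inner ℂ (kernelVec hα0 hz) u = Complex.exp (α * L z) := by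
    intro z hz
    rw [h z hz, inner_add_right, inner_smul_right, inner_smul_right, inner_kernelVec,
      inner_kernelVec]
  rw [bergmanNorm_eq_of_seqSpace (hβ.trans hβα.le) hL hF hu]
  obtain ⟨a, ha⟩ := exists_hasSum (H := fun z => Complex.exp (β * L z)) (hL.const_mul _).cexp
  by_cases hfin : coeffNormSq β a = ∞
  · rw [bergmanNorm_eq hβ hL hF ha, hfin, ENNReal.top_rpow_of_pos (by positivity)]
    exact ENNReal.ofReal_lt_top
  obtain ⟨v, hv⟩ := exists_seqSpace hβ0 hfin
  have hv' : ∀ z, ∀ hz : z ∈ disc, inner ℂ (kernelVec hβ0 hz) v = Complex.exp (β * L z) :=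
    fun z hz => (hasSum_inner_kernelVec hβ0 hz v).unique ((ha z hz).congr_fun fun n => by
      rw [hv n])
  rw [bergmanNorm_eq_of_seqSpace hβ hL hF hv']
  have hv0 : v ≠ 0 := by
    rintro rfl
    have := hv' 0 zero_mem_disc
    rw [inner_zero_right] at this
    exact Complex.exp_ne_zero _ this.symm
  have hvn : 0 < ‖v‖ := norm_pos_iff.2 hv0
  -- `e^ν` is the norm of `F` in the larger space; all data are divided by it
  set ν : ℝ := Real.log ‖v‖ / β with hν
  have hvν : ‖v‖ = Real.exp (β * ν) := by
    rw [hν, mul_div_cancel₀ _ hβ0.ne', Real.exp_log hvn]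
  let v₁ : SeqSpace := Complex.exp (-(β * ν)) • v
  let u₁ : SeqSpace := Complex.exp (-(α * ν)) • u
  have hv₁ : ‖v₁‖ = 1 := by
    rw [norm_smul, hvν, Complex.norm_exp, ← Real.exp_add, Real.exp_eq_one_iff]
    simp
  have hiv : ∀ z, ∀ hz : z ∈ disc, inner ℂ (unitKernel hβ0 hz) v₁
      = Complex.exp (β * (L z + halfLog z - ν)) := by
    intro z hz
    rw [inner_unitKernel_left, inner_smul_right, hv', ← Complex.exp_add, ← Complex.exp_add]
    congr 1; ring
  have hiu : ∀ z, ∀ hz : z ∈ disc, inner ℂ (unitKernel hα0 hz) u₁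
      = Complex.exp (α * (L z + halfLog z - ν)) := by
    intro z hz
    rw [inner_unitKernel_left, inner_smul_right, hu, ← Complex.exp_add, ← Complex.exp_add]
    congr 1; ring
  have hlt : ∀ z, ∀ hz : z ∈ disc, ‖inner ℂ (unitKernel hβ0 hz) v₁‖ < 1 := by
    intro z hz
    refine lt_of_le_of_ne ((norm_inner_le_norm _ _).trans_eq ?_) fun h1 => hns ?_
    · rw [norm_unitKernel, hv₁, one_mul]
    obtain ⟨c, hc⟩ := eq_smul_kernelVec hβ0 hz hv₁ h1
    have hvc : v = (Complex.exp (β * ν) * c) • kernelVec hβ0 hz := by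
      rw [mul_smul, ← hc, smul_smul, ← Complex.exp_add, add_neg_cancel, Complex.exp_zero, one_smul]
    obtain ⟨κ, hκ⟩ := exists_log_eq_of_exp_eq_kernel hL hβ0 (c := Complex.exp (β * ν) * c) hz
      fun y hy => by
        rw [← hv' y hy, hvc, inner_smul_right, inner_kernelVec]
    exact ⟨κ, z, hz, hκ⟩
  -- `e^P` and `e^Q` are the entry `⟨k₂, v₁⟩` and the product `⟨k₂, k₁⟩⟨k₁, v₁⟩` of the Gram matrix
  set P : ℂ := β * (L w₂ + halfLog w₂ - ν) with hP
  set Q : ℂ := β * (halfLog w₁ + halfLog w₂ - logDenom w₁ w₂) + β * (L w₁ + halfLog w₁ - ν) with hQ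
  have hbound := norm_inner_sub_sq_le (unitKernel hβ0 hw₁) (unitKernel hβ0 hw₂) v₁
    (norm_unitKernel _ _) (norm_unitKernel _ _)
  set x : ℝ := ‖inner ℂ (unitKernel hβ0 hw₁) v₁‖ with hx
  set t : ℝ := ‖inner ℂ (unitKernel hβ0 hw₁) (unitKernel hβ0 hw₂)‖ with ht
  have ht' : t = ‖inner ℂ (unitKernel hβ0 hw₂) (unitKernel hβ0 hw₁)‖ := by
    rw [ht, norm_inner_symm]
  have hγ : 1 < α / β := by rwa [one_lt_div hβ0]
  have hγβ : ((α / β : ℝ) : ℂ) * β = α := by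
    push_cast
    exact div_mul_cancel₀ _ (by exact_mod_cast hβ0.ne')
  have hpow : ∀ s : ℂ, (‖Complex.exp (β * s)‖ ^ 2) ^ (α / β) = ‖Complex.exp (α * s)‖ ^ 2 := by
    intro s
    rw [Complex.norm_exp, Complex.norm_exp, ← Real.exp_nat_mul, ← Real.exp_nat_mul, ← Real.exp_mul]
    congr 1
    simp
    field_simp
  have him : |(P - Q).im| < Real.pi := by
    have h1 := abs_im_lt_pi hL hw₁ hw₂ hne h
    rw [logDenom_self hw₁] at h1
    have e1 : (P - Q).im = β * (L w₂ + logDenom w₁ w₂ - L w₁).im := by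
      simp [hP, hQ]; ring
    have e2 : (α * (L w₂ + logDenom w₁ w₂ - (L w₁ + ((2 * halfLog w₁ : ℝ) : ℂ)))).im
        = α * (L w₂ + logDenom w₁ w₂ - L w₁).im := by
      simp
    rw [e1, abs_mul, abs_of_pos hβ0]
    rw [e2, abs_mul, abs_of_pos hα0] at h1
    exact (mul_le_mul_of_nonneg_right hβα.le (abs_nonneg _)).trans_lt h1
  have hxpos : 0 < x := by rw [hx, hiv]; exact norm_pos_iff.2 (Complex.exp_ne_zero _)
  have htpos : 0 < t := by
    rw [ht', inner_unitKernel]; exact norm_pos_iff.2 (Complex.exp_ne_zero _)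
  have htlt : t < 1 := norm_inner_unitKernel_lt_one hβ0 hw₁ hw₂ hne
  have hcore := norm_exp_sub_exp_sq_lt (P := P) (Q := Q) hxpos (hlt w₁ hw₁) htpos htlt hγ
    (by rw [hQ, Complex.exp_add, norm_mul, hx, ht', hiv, inner_unitKernel, mul_comm])
    (by rw [hP, ← hiv w₂ hw₂]; exact hlt w₂ hw₂) him
    (by
      rw [hv₁, one_pow, hiv, hiv, inner_unitKernel, ← Complex.exp_add] at hbound
      exact hbound)
  -- the same data at the exponent `α`
  have hspan := norm_sq_mul_eq_of_span (unitKernel hα0 hw₁) (unitKernel hα0 hw₂) u₁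
    (Complex.exp (-(α * ν)) * c₁ * Complex.exp (-(α * halfLog w₁)))
    (Complex.exp (-(α * ν)) * c₂ * Complex.exp (-(α * halfLog w₂)))
    (norm_unitKernel _ _) (norm_unitKernel _ _) (by
      have e : ∀ w : ℂ, Complex.exp (-(α * halfLog w)) * (Real.exp (α * halfLog w) : ℂ) = 1 := by
        intro w
        push_cast
        rw [← Complex.exp_add, neg_add_cancel, Complex.exp_zero]
      simp only [u₁, u, unitKernel, smul_add, smul_smul]
      rw [mul_assoc _ (Complex.exp (-(α * halfLog w₁))), e,
        mul_assoc _ (Complex.exp (-(α * halfLog w₂))), e, mul_one, mul_one])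
  have hX : ‖inner ℂ (unitKernel hα0 hw₁) u₁‖ ^ 2 = (x ^ 2) ^ (α / β) := by
    rw [hx, hiv, hiu, hpow]
  have hT : ‖inner ℂ (unitKernel hα0 hw₁) (unitKernel hα0 hw₂)‖ ^ 2 = (t ^ 2) ^ (α / β) := by
    rw [ht', norm_inner_symm, inner_unitKernel, inner_unitKernel, hpow]
  rw [hX, hT, hiu, hiu, inner_unitKernel, ← Complex.exp_add] at hspan
  have e1 : ((α / β : ℝ) : ℂ) * P = α * (L w₂ + halfLog w₂ - ν) := by
    rw [hP, ← mul_assoc, hγβ]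
  have e2 : ((α / β : ℝ) : ℂ) * Q = α * (halfLog w₁ + halfLog w₂ - logDenom w₁ w₂)
      + α * (L w₁ + halfLog w₁ - ν) := by
    rw [hQ, mul_add, ← mul_assoc, ← mul_assoc, hγβ]
  rw [e1, e2, ← hspan] at hcore
  have hT1 : 0 < 1 - (t ^ 2) ^ (α / β) := by
    have := Real.rpow_lt_one (by positivity) (by nlinarith : t ^ 2 < 1)
      (by positivity : 0 < α / β)
    linarith
  have hu1 : ‖u₁‖ < 1 := by
    have := lt_of_mul_lt_mul_right hcore hT1.le
    nlinarith [norm_nonneg u₁]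
  have hun : ‖u‖ < Real.exp (α * ν) := by
    rw [norm_smul, Complex.norm_exp] at hu1
    have e : (-(α * ν : ℂ)).re = -(α * ν) := by simp
    rw [e, Real.exp_neg, inv_mul_lt_iff₀ (Real.exp_pos _), mul_one] at hu1
    exact hu1
  rw [ENNReal.ofReal_lt_ofReal_iff (by positivity)]
  calc ‖u‖ ^ (1 / α) < Real.exp (α * ν) ^ (1 / α) :=
        Real.rpow_lt_rpow (norm_nonneg _) hun (by positivity)
    _ = ‖v‖ ^ (1 / β) := by
        rw [hvν, ← Real.exp_mul, ← Real.exp_mul]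
        congr 1; field_simp

/-! ### Inner factors -/

lemma isInner_one : IsInner fun _ => 1 :=
  ⟨differentiableOn_const _, fun _ _ => by simp,
    Eventually.of_forall fun _ => ⟨1, by simp, tendsto_const_nhds⟩⟩

/-- If `|F|` extends continuously to the closed disc, then multiplication of `F` by an inner
function does not change the limit of the integral means. -/
lemma tendsto_circleMean {η F f : ℂ → ℂ} {E : ℂ → ℝ} (hη : IsInner η) (hF : ContinuousOn F disc)
    (hE : ContinuousOn E (Metric.closedBall 0 1)) (hFE : ∀ z ∈ disc, ‖F z‖ = E z)
    (hfac : ∀ z ∈ disc, f z = η z * F z) :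
    Tendsto (circleMean f) (𝓝[<] 1) (𝓝 (∫⁻ θ in Ioc (0 : ℝ) (2 * Real.pi),
      ENNReal.ofReal (E (Complex.exp (θ * Complex.I)) ^ 2 / (2 * Real.pi)))) := by
  obtain ⟨C, hC⟩ := (isCompact_closedBall (0 : ℂ) 1).exists_bound_of_continuousOn hE
  have hIoo : ∀ᶠ r : ℝ in 𝓝[<] 1, r ∈ Ioo (0 : ℝ) 1 := Ioo_mem_nhdsLT zero_lt_one
  refine tendsto_lintegral_filter_of_dominated_convergence
    (fun _ => ENNReal.ofReal (C ^ 2 / (2 * Real.pi))) ?_ ?_ ?_ ?_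
  · filter_upwards [hIoo] with r hr
    have hc : Continuous fun θ : ℝ => f (r * Complex.exp (θ * Complex.I)) :=
      ContinuousOn.comp_continuous (s := disc)
        ((hη.1.continuousOn.mul hF).congr hfac) (by fun_prop) (mul_exp_mem_disc hr)
    exact (ENNReal.continuous_ofReal.comp ((hc.norm.pow 2).div_const _)).measurable
  · filter_upwards [hIoo] with r hr
    refine Eventually.of_forall fun θ => ENNReal.ofReal_le_ofReal ?_
    have hz := mul_exp_mem_disc hr θ
    have h1 : ‖f (r * Complex.exp (θ * Complex.I))‖ ≤ C := by
      rw [hfac _ hz, norm_mul, hFE _ hz]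
      refine (mul_le_mul (hη.2.1 _ hz) ((le_abs_self _).trans
        (hC _ (Metric.ball_subset_closedBall hz))) ?_ zero_le_one).trans_eq (one_mul _)
      rw [← hFE _ hz]; exact norm_nonneg _
    gcongr
  · rw [lintegral_const, Measure.restrict_apply_univ, Real.volume_Ioc]
    exact ENNReal.mul_ne_top ENNReal.ofReal_ne_top ENNReal.ofReal_ne_top
  · refine ae_restrict_of_ae ?_
    filter_upwards [hη.2.2] with θ hθ
    obtain ⟨ζ, hζ, hlim⟩ := hθ
    refine (ENNReal.continuous_ofReal.tendsto _).comp ((Tendsto.div_const ?_ _))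
    have hEt : Tendsto (fun r : ℝ => E (r * Complex.exp (θ * Complex.I))) (𝓝[<] 1)
        (𝓝 (E (Complex.exp (θ * Complex.I)))) := by
      refine (hE (Complex.exp (θ * Complex.I)) (by simp [Complex.norm_exp_ofReal_mul_I])).tendsto.comp
        (tendsto_nhdsWithin_iff.2 ⟨?_, ?_⟩)
      · have : Continuous fun r : ℝ => (r : ℂ) * Complex.exp (θ * Complex.I) := by fun_prop
        simpa using (this.tendsto 1).mono_left nhdsWithin_le_nhds
      · filter_upwards [hIoo] with r hr
        exact Metric.ball_subset_closedBall (mul_exp_mem_disc hr θ)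
    have := (hlim.norm.mul hEt).pow 2
    rw [hζ, one_mul] at this
    refine this.congr' ?_
    filter_upwards [hIoo] with r hr
    have hz := mul_exp_mem_disc hr θ
    rw [hfac _ hz, norm_mul, hFE _ hz]

/-- Hardy norms are not changed by an inner factor when `|F|` extends continuously to the closed
disc. -/
lemma hardyNorm_two_eq_of_inner {η F f : ℂ → ℂ} {E : ℂ → ℝ} (hη : IsInner η)
    (hF : DifferentiableOn ℂ F disc) (hE : ContinuousOn E (Metric.closedBall 0 1))
    (hFE : ∀ z ∈ disc, ‖F z‖ = E z) (hfac : ∀ z ∈ disc, f z = η z * F z) :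
    hardyNorm 2 f = hardyNorm 2 F := by
  have hf := tendsto_circleMean hη hF.continuousOn hE hFE hfac
  have hFt := tendsto_circleMean isInner_one hF.continuousOn hE hFE (f := F) (by simp)
  have hIoo : ∀ᶠ r : ℝ in 𝓝[<] 1, r ∈ Ioo (0 : ℝ) 1 := Ioo_mem_nhdsLT zero_lt_one
  obtain ⟨a, ha⟩ := exists_hasSum hF
  rw [hardyNorm_two, hardyNorm_two]
  congr 1
  refine le_antisymm (iSup₂_mono fun r hr => ?_) (iSup₂_le fun r hr => ?_)
  · refine lintegral_mono fun θ => ENNReal.ofReal_le_ofReal ?_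
    have hz := mul_exp_mem_disc hr θ
    have : ‖f (r * Complex.exp (θ * Complex.I))‖ ≤ ‖F (r * Complex.exp (θ * Complex.I))‖ := by
      rw [hfac _ hz, norm_mul]
      exact mul_le_of_le_one_left (norm_nonneg _) (hη.2.1 _ hz)
    gcongr
  · -- the means of `F` increase to their limit, which is also the limit of the means of `f`
    refine (ge_of_tendsto hFt ?_).trans (le_of_tendsto hf ?_)
    · filter_upwards [Ioo_mem_nhdsLT hr.2] with s hs
      rw [circleMean_eq hF.continuousOn ha hr,
        circleMean_eq hF.continuousOn ha ⟨hr.1.trans hs.1, hs.2⟩]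
      refine ENNReal.tsum_le_tsum fun n => ENNReal.ofReal_le_ofReal ?_
      have := hr.1
      have := hs.1.le
      gcongr
    · filter_upwards [hIoo] with s hs
      exact le_iSup₂ (f := fun (s : ℝ) (_ : s ∈ Ioo (0 : ℝ) 1) => circleMean f s) s hs

lemma continuousOn_kernel {w : ℂ} (hw : w ∈ disc) (a : ℝ) :
    ContinuousOn (kernel w a) (Metric.closedBall 0 1) :=
  (continuousOn_const.mul (continuousOn_logDenom hw)).neg.cexp.congr fun z hz =>
    kernel_eq_exp hw (by simpa using hz) a

/-- The integral that defines the norm of `A^{2α}_α`. -/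
lemma bergmanNorm_of_one_lt {α : ℝ} (hα : 1 < α) (f : ℂ → ℂ) :
    bergmanNorm α (2 * α) f = (∫⁻ z in disc, ENNReal.ofReal (((1 - ‖z‖ ^ 2) ^ 2)⁻¹ / Real.pi) *
      ENNReal.ofReal (‖f z‖ ^ (2 * α) * (α - 1) * (1 - ‖z‖ ^ 2) ^ α)) ^ (1 / (2 * α)) := by
  rw [bergmanNorm, if_neg hα.ne', lintegral_invariantMeasure]

lemma bergmanNorm_mono {α : ℝ} (hα : 1 < α) {f F : ℂ → ℂ} (h : ∀ z ∈ disc, ‖f z‖ ≤ ‖F z‖) :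
    bergmanNorm α (2 * α) f ≤ bergmanNorm α (2 * α) F := by
  rw [bergmanNorm_of_one_lt hα, bergmanNorm_of_one_lt hα]
  refine ENNReal.rpow_le_rpow (setLIntegral_mono' isOpen_disc.measurableSet fun z hz => ?_)
    (by positivity)
  have h1 : 0 < 1 - ‖z‖ ^ 2 := by nlinarith [mem_disc_iff.1 hz, norm_nonneg z]
  have := h z hz
  have : 0 ≤ α - 1 := by linarith
  gcongr

lemma bergmanNorm_strict_mono {α : ℝ} (hα : 1 < α) {f F : ℂ → ℂ} (hF : ContinuousOn F disc)
    (h : ∀ z ∈ disc, ‖f z‖ < ‖F z‖) (hfin : bergmanNorm α (2 * α) F ≠ ∞) :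
    bergmanNorm α (2 * α) f < bergmanNorm α (2 * α) F := by
  have hle := bergmanNorm_mono hα (fun z hz => (h z hz).le)
  have hfin' : bergmanNorm α (2 * α) f ≠ ∞ := (hle.trans_lt hfin.lt_top).ne
  rw [bergmanNorm_of_one_lt hα] at hfin' ⊢
  rw [bergmanNorm_of_one_lt hα]
  have hmd : MeasurableSet disc := isOpen_disc.measurableSet
  have hpos : (0 : ℝ) < 1 / (2 * α) := by positivity
  refine ENNReal.rpow_lt_rpow (lintegral_strict_mono ?_ ?_ ?_ ?_) hpos
  · rw [Ne, Measure.restrict_eq_zero]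
    exact (isOpen_disc.measure_pos _ ⟨0, zero_mem_disc⟩).ne'
  · have hFm : AEMeasurable F (volume.restrict disc) := hF.aemeasurable hmd
    fun_prop
  · intro ht
    rw [ht, ENNReal.top_rpow_of_pos hpos] at hfin'
    exact hfin' rfl
  · rw [ae_restrict_iff' hmd]
    refine Eventually.of_forall fun z hz => ?_
    have h1 : 0 < 1 - ‖z‖ ^ 2 := by nlinarith [mem_disc_iff.1 hz, norm_nonneg z]
    have h2 : 0 < α - 1 := by linarith
    have h3 : ‖f z‖ ^ (2 * α) < ‖F z‖ ^ (2 * α) :=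
      Real.rpow_lt_rpow (norm_nonneg _) (h z hz) (by positivity)
    have h4 := Real.rpow_pos_of_pos h1 α
    have h5 : 0 ≤ ‖f z‖ ^ (2 * α) := by positivity
    rw [← ENNReal.ofReal_mul (by positivity), ← ENNReal.ofReal_mul (by positivity),
      ENNReal.ofReal_lt_ofReal_iff (by
        have : 0 < ‖F z‖ ^ (2 * α) := h5.trans_lt h3
        positivity)]
    have hpi := Real.pi_pos
    gcongr

/-- An inner function attaining modulus one in the disc is constant. -/
lemma eq_const_of_norm_eq_one {η : ℂ → ℂ} (hη : IsInner η) {z₀ : ℂ} (hz₀ : z₀ ∈ disc)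
    (h : 1 ≤ ‖η z₀‖) : ∀ z ∈ disc, η z = η z₀ := fun _ hz =>
  Complex.eqOn_of_isPreconnected_of_isMaxOn_norm isPreconnected_disc isOpen_disc hη.1 hz₀
    (fun y hy => (hη.2.1 y hy).trans h) hz

lemma exists_ne_zero_of_isInner {η : ℂ → ℂ} (hη : IsInner η) : ∃ z ∈ disc, η z ≠ 0 := by
  by_contra! h0
  obtain ⟨θ, ζ, hζ, hlim⟩ := hη.2.2.exists
  have : Tendsto (fun r : ℝ => η (r * Complex.exp (θ * Complex.I))) (𝓝[<] 1) (𝓝 0) := by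
    refine tendsto_const_nhds.congr' ?_
    filter_upwards [Ioo_mem_nhdsLT (zero_lt_one' ℝ)] with r hr
    exact (h0 _ (mul_exp_mem_disc hr θ)).symm
  rw [tendsto_nhds_unique hlim this, norm_zero] at hζ
  exact zero_ne_one hζ

end DiskSpaces

open DiskSpaces

theorem mainTheorem1
    (f η F Fα : ℂ → ℂ) (α : ℝ) (hα : 1 < α)
    (hf : DiskSpaces.MemHardy 2 f)
    (hη : DiskSpaces.IsInner η)
    (hF : DifferentiableOn ℂ F DiskSpaces.disc)
    (hF0 : ∀ z ∈ DiskSpaces.disc, F z ≠ 0)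
    (hfac : ∀ z ∈ DiskSpaces.disc, f z = η z * F z)
    (hpow : DiskSpaces.IsHolomorphicPower F α Fα)
    (c₁ c₂ w₁ w₂ : ℂ) (hw₁ : w₁ ∈ DiskSpaces.disc) (hw₂ : w₂ ∈ DiskSpaces.disc)
    (hcomb : ∀ z ∈ DiskSpaces.disc,
      Fα z = c₁ * DiskSpaces.kernel w₁ α z + c₂ * DiskSpaces.kernel w₂ α z) :
    (∀ β : ℝ, 1 ≤ β → β ≤ α →
      DiskSpaces.bergmanNorm α (2 * α) F ≤ DiskSpaces.bergmanNorm β (2 * β) F) ∧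
    (∀ β : ℝ, 1 ≤ β → β < α →
      (DiskSpaces.bergmanNorm α (2 * α) F = DiskSpaces.bergmanNorm β (2 * β) F ↔
        ∃ c w : ℂ, w ∈ DiskSpaces.disc ∧
          ∀ z ∈ DiskSpaces.disc, Fα z = c * DiskSpaces.kernel w α z)) ∧
    DiskSpaces.bergmanNorm α (2 * α) f ≤ DiskSpaces.hardyNorm 2 f ∧
    (DiskSpaces.bergmanNorm α (2 * α) f = DiskSpaces.hardyNorm 2 f ↔
      ∃ c w : ℂ, w ∈ DiskSpaces.disc ∧
        ∀ z ∈ DiskSpaces.disc, f z = c * DiskSpaces.kernel w 1 z) := by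
  obtain ⟨L, hL, hFL, hFαL⟩ := hpow
  have hα0 : 0 < α := by linarith
  have hcomb' : ∀ z ∈ disc, Complex.exp (α * L z) = c₁ * kernel w₁ α z + c₂ * kernel w₂ α z :=
    fun z hz => by rw [← hFαL z hz, hcomb z hz]
  have hiff : (∃ c w : ℂ, w ∈ disc ∧ ∀ z ∈ disc, Fα z = c * kernel w α z) ↔
      ∃ κ w : ℂ, w ∈ disc ∧ ∀ z ∈ disc, L z = κ - logDenom w z := by
    constructor
    · rintro ⟨c, w, hw, h⟩
      obtain ⟨κ, hκ⟩ := exists_log_eq_of_exp_eq_kernel hL hα0 (c := c) hw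
        fun z hz => by rw [← hFαL z hz, h z hz]
      exact ⟨κ, w, hw, hκ⟩
    · rintro ⟨κ, w, hw, h⟩
      exact ⟨_, w, hw, fun z hz => by rw [hFαL z hz, exp_eq_kernel_of_log_eq hw h α hz]⟩
  have hsingle : (∃ κ w : ℂ, w ∈ disc ∧ ∀ z ∈ disc, L z = κ - logDenom w z) →
      ∀ β, 1 ≤ β → bergmanNorm α (2 * α) F = bergmanNorm β (2 * β) F := by
    rintro ⟨κ, w, hw, h⟩ β hβ
    rw [bergmanNorm_of_log_eq hα.le hL hFL hw h, bergmanNorm_of_log_eq hβ hL hFL hw h]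
  have hle : ∀ β : ℝ, 1 ≤ β → β ≤ α → bergmanNorm α (2 * α) F ≤ bergmanNorm β (2 * β) F := by
    intro β hβ hβα
    rcases eq_or_lt_of_le hβα with rfl | hlt
    · exact le_rfl
    by_cases hs : ∃ κ w : ℂ, w ∈ disc ∧ ∀ z ∈ disc, L z = κ - logDenom w z
    · exact (hsingle hs β hβ).le
    · exact (bergmanNorm_lt hL hFL hβ hlt hw₁ hw₂ hcomb' hs).le
  have heq : ∀ β : ℝ, 1 ≤ β → β < α →
      (bergmanNorm α (2 * α) F = bergmanNorm β (2 * β) F ↔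
        ∃ κ w : ℂ, w ∈ disc ∧ ∀ z ∈ disc, L z = κ - logDenom w z) := by
    intro β hβ hlt
    refine ⟨fun h => ?_, fun h => hsingle h β hβ⟩
    by_contra hs
    exact (bergmanNorm_lt hL hFL hβ hlt hw₁ hw₂ hcomb' hs).ne h
  have hone : ∀ g : ℂ → ℂ, bergmanNorm 1 (2 * 1) g = hardyNorm 2 g := fun g => by
    rw [bergmanNorm, if_pos rfl, mul_one]
  -- `|F| = |F^α|^{1/α}` extends continuously to the closed disc
  have hhardy : hardyNorm 2 f = hardyNorm 2 F := by
    refine hardyNorm_two_eq_of_inner hη hF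
      (E := fun z => ‖c₁ * kernel w₁ α z + c₂ * kernel w₂ α z‖ ^ (1 / α)) ?_ ?_ hfac
    · exact (((continuousOn_const.mul (continuousOn_kernel hw₁ α)).add
        (continuousOn_const.mul (continuousOn_kernel hw₂ α))).norm).rpow_const
        fun z _ => Or.inr (by positivity)
    · intro z hz
      rw [← hcomb' z hz, hFL z hz, Complex.norm_exp, Complex.norm_exp, ← Real.exp_mul]
      congr 1
      simp
      field_simp
  have hmono : bergmanNorm α (2 * α) f ≤ bergmanNorm α (2 * α) F :=
    bergmanNorm_mono hα fun z hz => by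
      rw [hfac z hz, norm_mul]
      exact mul_le_of_le_one_left (norm_nonneg _) (hη.2.1 z hz)
  have hFH : bergmanNorm α (2 * α) F ≤ hardyNorm 2 f := by
    rw [hhardy, ← hone]; exact hle 1 le_rfl hα.le
  refine ⟨hle, fun β hβ hlt => (heq β hβ hlt).trans hiff.symm, hmono.trans hFH, ?_, ?_⟩
  · intro h
    have h1 : bergmanNorm α (2 * α) F = hardyNorm 2 f := le_antisymm hFH (h ▸ hmono)
    obtain ⟨κ, w, hw, hκ⟩ := (heq 1 le_rfl hα).1 (by rw [hone, h1, hhardy])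
    have hfin : bergmanNorm α (2 * α) F ≠ ∞ := by rw [h1]; exact hf.2.ne
    obtain ⟨z₀, hz₀, hη₀⟩ : ∃ z₀ ∈ disc, 1 ≤ ‖η z₀‖ := by
      by_contra! hlt
      refine (bergmanNorm_strict_mono hα hF.continuousOn (f := f) (fun z hz => ?_) hfin).ne
        (h.trans h1.symm)
      rw [hfac z hz, norm_mul]
      exact mul_lt_of_lt_one_left (norm_pos_iff.2 (hF0 z hz)) (hlt z hz)
    refine ⟨η z₀ * Complex.exp κ, w, hw, fun z hz => ?_⟩
    have := exp_eq_kernel_of_log_eq hw hκ 1 hz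
    rw [Complex.ofReal_one, one_mul, one_mul] at this
    rw [hfac z hz, eq_const_of_norm_eq_one hη hz₀ hη₀ z hz, hFL z hz, this, mul_assoc]
  · rintro ⟨c, w, hw, h⟩
    have hc : c ≠ 0 := by
      rintro rfl
      obtain ⟨z, hz, hηz⟩ := exists_ne_zero_of_isInner hη
      have := h z hz
      rw [hfac z hz, zero_mul] at this
      exact mul_ne_zero hηz (hF0 z hz) this
    have hL' : DifferentiableOn ℂ (fun z => Complex.log c - logDenom w z) disc :=
      (differentiableOn_logDenom hw).const_sub _
    have hfL : ∀ z ∈ disc, f z = Complex.exp (Complex.log c - logDenom w z) := by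
      intro z hz
      rw [h z hz, kernel_eq_exp hw (mem_disc_iff.1 hz).le, sub_eq_add_neg, Complex.exp_add,
        Complex.exp_log hc, Complex.ofReal_one, one_mul]
    rw [← hone, bergmanNorm_of_log_eq hα.le hL' hfL hw (fun _ _ => rfl),
      bergmanNorm_of_log_eq le_rfl hL' hfL hw (fun _ _ => rfl)]
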